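/- \textbf{Conventions.} A \emph{sketch} $\mathcal S=(S,\mathsf L_{\mathcal S},\mathsf C_{\mathcal S})$ is a locally small (possibly large) category $S$ with a class $\mathsf L_{\mathcal S}$ of cones and a class $\mathsf C_{\mathcal S}$ of cocones over essentially small diagrams. A morphism of sketches is a functor sending each specified cone (cocone) to one naturally isomorphic to a specified cone (cocone) of the target; 2-cells are all natural transformations. This is the 2-category $\mathsf{Skt}$. A sketch is \emph{small} if $S$ is essentially small and, up to natural isomorphism and equivalence of shapes, $\mathsf C_{\mathcal S}$ is a set. A \emph{left sketch} is a sketch whose category is cocomplete and whose specified cocones are exactly the colimit cocones over essentially small diagrams. A morphism $F:\mathcal S\to\mathcal T$ is a \emph{Morita equivalence} if $F^*:\mathsf{Skt}(\mathcal T,\mathcal M)\to\mathsf{Skt}(\mathcal S,\mathcal M)$ is an equivalence of categories for every left sketch $\mathcal M$; a sketch $\mathcal S$ is \emph{Morita small} if there is a Morita equivalence $\mathcal D\to\mathcal S$ with $\mathcal D$ small. For a sketch $\mathcal S$ let $\hat S$ be the full subcategory of $[S^{\mathrm{op}},\mathrm{Set}]$ on the presheaves orthogonal to the canonical maps $\mathrm{colim}\,(y\circ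 d)\to y(s)$ for all $(d\Rightarrow s)\in\mathsf C_{\mathcal S}$, where $y$ is the Yoneda embedding, and let $J_{\mathcal S}:S\to\hat S$ send $s$ to the reflection of $y(s)$ into $\hat S$. If $\hat S$ is locally small and these reflections exist, the \emph{left sketch classifier} of $\mathcal S$ is $\hat S$ with specified cones the $J_{\mathcal S}\sigma$, $\sigma\in\mathsf L_{\mathcal S}$, and specified cocones all colimit cocones over essentially small diagrams. The sketch $\mathcal S$ is \emph{rounded} if these reflections exist and $J_{\mathcal S}$ sends every cone of $\mathsf L_{\mathcal S}$ to a limit cone in $\hat S$. A \emph{logos} is a rounded left sketch. Let $r\mathsf{Skt}^{\mathsf M}$ and $\mathsf{Log}^{\mathsf M}$ be the full sub-2-categories of $\mathsf{Skt}$ on the Morita small rounded sketches and on the Morita small logoi. \textbf{Theorem (Diaconescu for logoi).} The inclusion $U:\mathsf{Log}^{\mathsf M}\hookrightarrow r\mathsf{Skt}^{\mathsf M}$ is bireflective: it is locally an equivalence, and there are a pseudofunctor $\mathcal{C}l[-]:r\mathsf{Skt}^{\mathsf M}\to\mathsf{Log}^{\mathsf M}$ and a pseudonatural transformation $\eta:\mathrm{id}\Rightarrow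 U\,\mathcal{C}l[-]$ such that for all $\mathcal S\in r\mathsf{Skt}^{\mathsf M}$ and $\mathcal T\in\mathsf{Log}^{\mathsf M}$ the functor $G\mapsto UG\circ\eta_{\mathcal S}$ is an equivalence of categories $$\mathsf{Log}^{\mathsf M}(\mathcal{C}l[\mathcal S],\mathcal T)\simeq r\mathsf{Skt}^{\mathsf M}(\mathcal S,U\mathcal T),$$ and the resulting counit $\mathcal{C}l[U\mathcal T]\to\mathcal T$ is an equivalence for every $\mathcal T\in\mathsf{Log}^{\mathsf M}$. For every $\mathcal S\in r\mathsf{Skt}^{\mathsf M}$ the left sketch classifier of $\mathcal S$ exists, and there is an equivalence in $\mathsf{Skt}$ between $\mathcal{C}l[\mathcal S]$ and it that identifies $\eta_{\mathcal S}$ with $J_{\mathcal S}$ up to isomorphism. Moreover, for every logos $\mathcal T$, Morita small or not, precomposition with $\eta_{\mathcal S}$ is an equivalence $\mathsf{Skt}(\mathcal{C}l[\mathcal S],\mathcal T)\simeq\mathsf{Skt}(\mathcal S,\mathcal T)$. -/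

import Mathlib

open CategoryTheory CategoryTheory.Limits

universe w v u v' u'

noncomputable section

namespace LogosTheory

/-! ### Natural isomorphism of (co)cones -/

section Cones

variable {J : Type u'} [Category.{v'} J] {C : Type u} [Category.{v} C]

/-- Two cones with the same shape, over possibly different diagrams, are naturally isomorphic. -/
def ConeNatIso {d d' : J ⥤ C} (c : Cone d) (c' : Cone d') : Prop :=
  ∃ (α : d ≅ d') (e : c.pt ≅ c'.pt), ∀ j : J, e.hom ≫ c'.π.app j = c.π.app j ≫ α.hom.app j

/-- Two cocones with the same shape, over possibly different diagrams, are naturally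
isomorphic. -/
def CoconeNatIso {d d' : J ⥤ C} (c : Cocone d) (c' : Cocone d') : Prop :=
  ∃ (α : d ≅ d') (e : c.pt ≅ c'.pt), ∀ j : J, c.ι.app j ≫ e.hom = α.hom.app j ≫ c'.ι.app j

theorem ConeNatIso.refl {d : J ⥤ C} (c : Cone d) : ConeNatIso c c :=
  ⟨Iso.refl _, Iso.refl _, fun j => by simp⟩

theorem CoconeNatIso.refl {d : J ⥤ C} (c : Cocone d) : CoconeNatIso c c :=
  ⟨Iso.refl _, Iso.refl _, fun j => by simp⟩

end Cones

/-! ### The 2-category of sketches -/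

/-- A sketch: a locally small (possibly large) category with a class of cones and a class of
cocones over essentially small diagrams.  "Small" means `w`-small, a large category has
its objects in `Type (w + 1)`. -/
structure Sketch where
  /-- the underlying category -/
  C : Type (w + 1)
  [cat : Category.{w} C]
  /-- the class of specified cones -/
  IsCone : ∀ {J : Type (w + 1)} [Category.{w} J] [EssentiallySmall.{w} J] {d : J ⥤ C},
    Cone d → Prop
  /-- the class of specified cocones -/
  IsCocone : ∀ {J : Type (w + 1)} [Category.{w} J] [EssentiallySmall.{w} J] {d : J ⥤ C},
    Cocone d → Prop

namespace Sketch

attribute [instance] Sketch.cat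

/-- A morphism of sketches: a functor sending each specified (co)cone to a (co)cone that is
naturally isomorphic to a specified one. -/
structure Hom (S T : Sketch.{w}) where
  /-- the underlying functor -/
  functor : S.C ⥤ T.C
  map_cone : ∀ {J : Type (w + 1)} [Category.{w} J] [EssentiallySmall.{w} J] {d : J ⥤ S.C}
    (c : Cone d), S.IsCone c →
      ∃ (d' : J ⥤ T.C) (c' : Cone d'), T.IsCone c' ∧ ConeNatIso (functor.mapCone c) c'
  map_cocone : ∀ {J : Type (w + 1)} [Category.{w} J] [EssentiallySmall.{w} J] {d : J ⥤ S.C}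
    (c : Cocone d), S.IsCocone c →
      ∃ (d' : J ⥤ T.C) (c' : Cocone d'), T.IsCocone c' ∧ CoconeNatIso (functor.mapCocone c) c'

/-- The identity morphism. -/
def Hom.id (S : Sketch.{w}) : Hom S S where
  functor := 𝟭 S.C
  map_cone {_ _ _ d} c hc := ⟨d, c, hc, Iso.refl _, Iso.refl _, fun j => by simp⟩
  map_cocone {_ _ _ d} c hc := ⟨d, c, hc, Iso.refl _, Iso.refl _, fun j => by simp⟩

/-- Composition of morphisms. -/
def Hom.comp {S T R : Sketch.{w}} (F : Hom S T) (G : Hom T R) : Hom S R where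
  functor := F.functor ⋙ G.functor
  map_cone {_ _ _ d} c hc := by
    obtain ⟨d', c', hc', α, e, h⟩ := F.map_cone c hc
    obtain ⟨d'', c'', hc'', β, f, h'⟩ := G.map_cone c' hc'
    refine ⟨d'', c'', hc'', (Functor.associator _ _ _).symm ≪≫
      Functor.isoWhiskerRight α G.functor ≪≫ β, G.functor.mapIso e ≪≫ f, fun j => ?_⟩
    have h1 := congrArg G.functor.map (h j)
    have h2 := h' j
    simp only [Functor.mapCone_π_app, Functor.map_comp] at h1 h2
    simp [h2, reassoc_of% h1]
  map_cocone {_ _ _ d} c hc := by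
    obtain ⟨d', c', hc', α, e, h⟩ := F.map_cocone c hc
    obtain ⟨d'', c'', hc'', β, f, h'⟩ := G.map_cocone c' hc'
    refine ⟨d'', c'', hc'', (Functor.associator _ _ _).symm ≪≫
      Functor.isoWhiskerRight α G.functor ≪≫ β, G.functor.mapIso e ≪≫ f, fun j => ?_⟩
    have h1 := congrArg G.functor.map (h j)
    have h2 := h' j
    simp only [Functor.mapCocone_ι_app, Functor.map_comp] at h1 h2
    simp [← h2, reassoc_of% h1]

/-- 2-cells are arbitrary natural transformations. -/
instance (S T : Sketch.{w}) : Category (Hom S T) where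
  Hom F G := F.functor ⟶ G.functor
  id F := 𝟙 F.functor
  comp α β := NatTrans.vcomp α β

instance : CategoryStruct Sketch.{w} where
  Hom S T := Hom S T
  id S := Hom.id S
  comp F G := Hom.comp F G

instance homCat (S T : Sketch.{w}) : Category (S ⟶ T) :=
  inferInstanceAs (Category (Hom S T))

/-- The functor underlying a morphism of sketches. -/
abbrev functor {S T : Sketch.{w}} (F : S ⟶ T) : S.C ⥤ T.C := Hom.functor F

/-- A 2-cell of sketches from a natural transformation. -/
abbrev ofNatTrans {S T : Sketch.{w}} {F G : S ⟶ T} (η : functor F ⟶ functor G) : F ⟶ G := η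

/-- The natural transformation underlying a 2-cell of sketches. -/
abbrev natTrans {S T : Sketch.{w}} {F G : S ⟶ T} (η : F ⟶ G) : functor F ⟶ functor G := η

/-- An invertible 2-cell of sketches from a natural isomorphism. -/
def isoOfNatIso {S T : Sketch.{w}} {F G : S ⟶ T} (η : functor F ≅ functor G) : F ≅ G where
  hom := ofNatTrans η.hom
  inv := ofNatTrans η.inv
  hom_inv_id := η.hom_inv_id
  inv_hom_id := η.inv_hom_id

/-- Left whiskering of 2-cells. -/
def whiskerLeft {S T R : Sketch.{w}} (F : S ⟶ T) {G H : T ⟶ R} (η : G ⟶ H) : F ≫ G ⟶ F ≫ H :=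
  Functor.whiskerLeft (functor F) (natTrans η)

/-- Right whiskering of 2-cells. -/
def whiskerRight {S T R : Sketch.{w}} {F G : S ⟶ T} (η : F ⟶ G) (H : T ⟶ R) : F ≫ H ⟶ G ≫ H :=
  Functor.whiskerRight (natTrans η) (functor H)

/-- The 2-category `Skt` of sketches. -/
instance : Bicategory Sketch.{w} where
  homCategory := homCat
  whiskerLeft := whiskerLeft
  whiskerRight := whiskerRight
  associator F G H := isoOfNatIso (F := (F ≫ G) ≫ H) (G := F ≫ G ≫ H)
    (Functor.associator (functor F) (functor G) (functor H))
  leftUnitor F := isoOfNatIso (F := 𝟙 _ ≫ F) (Functor.leftUnitor (functor F))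
  rightUnitor F := isoOfNatIso (F := F ≫ 𝟙 _) (Functor.rightUnitor (functor F))
  whiskerLeft_id _ _ := by exact NatTrans.ext (funext fun _ => rfl)
  whiskerLeft_comp {_ _ _} _ {_ _ _} _ _ := by exact NatTrans.ext (funext fun _ => rfl)
  id_whiskerLeft η := by
    exact NatTrans.ext (funext fun X =>
      ((Category.id_comp _).trans (Category.comp_id ((natTrans η).app X))).symm)
  comp_whiskerLeft {_ _ _ _} F G {_ _} η := by
    exact NatTrans.ext (funext fun X => ((Category.id_comp _).trans
      (Category.comp_id ((natTrans η).app ((functor G).obj ((functor F).obj X))))).symm)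
  id_whiskerRight _ G := by exact NatTrans.ext (funext fun _ => (functor G).map_id _)
  comp_whiskerRight _ _ G := by exact NatTrans.ext (funext fun _ => (functor G).map_comp _ _)
  whiskerRight_id η := by
    exact NatTrans.ext (funext fun X =>
      ((Category.id_comp _).trans (Category.comp_id ((natTrans η).app X))).symm)
  whiskerRight_comp η G H := by
    exact NatTrans.ext (funext fun X => ((Category.id_comp _).trans
      (Category.comp_id ((functor H).map ((functor G).map ((natTrans η).app X))))).symm)
  whisker_assoc {_ _ _ _} F {_ _} η H := by
    exact NatTrans.ext (funext fun X => ((Category.id_comp _).trans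
      (Category.comp_id ((functor H).map ((natTrans η).app ((functor F).obj X))))).symm)
  whisker_exchange η θ := by
    exact NatTrans.ext (funext fun X =>
      ((natTrans θ).naturality ((natTrans η).app X)).symm)
  pentagon F G H I := by
    exact Functor.pentagon (functor F) (functor G) (functor H) (functor I)
  triangle F G := by exact Functor.triangle (functor F) (functor G)

/-- The bicategory `Skt` is a strict 2-category. -/
theorem strict : Bicategory.Strict Sketch.{w} where
  id_comp _ := rfl
  comp_id _ := rfl
  assoc _ _ _ := rfl
  leftUnitor_eqToIso _ := by exact Iso.ext rfl
  rightUnitor_eqToIso _ := by exact Iso.ext rfl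
  associator_eqToIso _ _ _ := by exact Iso.ext rfl

/-! ### Small sketches, left sketches, Morita equivalences -/

/-- A sketch is small if its underlying category is essentially small and, up to natural
isomorphism and equivalence of shapes, there is only a set of specified cocones. -/
structure IsSmall (S : Sketch.{w}) : Prop where
  essentiallySmall : EssentiallySmall.{w} S.C
  small_cocones : ∃ (ι : Type w) (K : ι → Type w) (_ : ∀ i, SmallCategory (K i))
    (f : ∀ i, K i ⥤ S.C) (γ : ∀ i, Cocone (f i)),
    ∀ {J : Type (w + 1)} [Category.{w} J] [EssentiallySmall.{w} J] {d : J ⥤ S.C} (c : Cocone d),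
      S.IsCocone c → ∃ (i : ι) (e : K i ≌ J), CoconeNatIso (γ i) (c.whisker e.functor)

/-- A left sketch: the category is cocomplete and the specified cocones are the colimit cocones
(of essentially small diagrams). -/
structure IsLeft (S : Sketch.{w}) : Prop where
  cocomplete : HasColimitsOfSize.{w, w} S.C
  isCocone_iff : ∀ {J : Type (w + 1)} [Category.{w} J] [EssentiallySmall.{w} J] {d : J ⥤ S.C}
    (c : Cocone d), S.IsCocone c ↔ Nonempty (IsColimit c)

/-- A (left) Morita equivalence: precomposition with it is an equivalence on models in every left
sketch. -/
def IsMoritaEquivalence {S T : Sketch.{w}} (F : S ⟶ T) : Prop :=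
  ∀ M : Sketch.{w}, M.IsLeft → (Bicategory.precomp M F).IsEquivalence

/-- A sketch is (left) Morita small if it admits a Morita equivalence from a small sketch. -/
def IsMoritaSmall (S : Sketch.{w}) : Prop :=
  ∃ (D : Sketch.{w}) (F : D ⟶ S), D.IsSmall ∧ IsMoritaEquivalence F

/-! ### The left sketch classifier -/

/-- The canonical maps `colim (y ∘ d) ⟶ y s` of presheaves on `S`, for the specified cocones
`d ⟹ s` of the sketch. -/
inductive comparison (S : Sketch.{w}) : MorphismProperty (S.Cᵒᵖ ⥤ Type w)
  | mk {J : Type (w + 1)} [Category.{w} J] [EssentiallySmall.{w} J] {d : J ⥤ S.C}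
      (δ : Cocone d) (hδ : S.IsCocone δ) (c : Cocone (d ⋙ yoneda)) (hc : IsColimit c) :
      comparison S (hc.desc (yoneda.mapCocone δ))

/-- The underlying category of the left sketch classifier: the presheaves orthogonal to all
the comparison maps. -/
abbrev Hat (S : Sketch.{w}) : Type (w + 1) :=
  (comparison S).isLocal.FullSubcategory

/-- The functor `J = L ∘ y : S ⥤ Hat S` sending `s` to the reflection of the representable presheaf
`y s` into the orthogonality class; `unit` is the unit of the reflection. -/
structure ReflectedYoneda (S : Sketch.{w}) where
  /-- the functor `J` -/
  functor : S.C ⥤ S.Hat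
  /-- the unit, with components `y s ⟶ J s` -/
  unit : (yoneda : S.C ⥤ S.Cᵒᵖ ⥤ Type w) ⟶ functor ⋙ (comparison S).isLocal.ι
  bijective : ∀ (s : S.C) (P : S.Hat),
    Function.Bijective fun f : functor.obj s ⟶ P => unit.app s ≫ f.hom

/-- A sketch is (left) rounded if the functor `J : S ⥤ Hat S` sends the specified cones to limit
cones. -/
def IsRounded (S : Sketch.{w}) : Prop :=
  ∃ R : S.ReflectedYoneda,
    ∀ {J : Type (w + 1)} [Category.{w} J] [EssentiallySmall.{w} J] {d : J ⥤ S.C} (c : Cone d),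
      S.IsCone c → Nonempty (IsLimit (R.functor.mapCone c))

/-- A logos is a (left) rounded left sketch. -/
structure IsLogos (S : Sketch.{w}) : Prop where
  isLeft : S.IsLeft
  isRounded : S.IsRounded

/-- The images of the specified cones of `S` under a functor. -/
inductive ImageCone (S : Sketch.{w}) {D : Type u} [Category.{v} D] (F : S.C ⥤ D) :
    ∀ {J : Type (w + 1)} [Category.{w} J] [EssentiallySmall.{w} J] {d : J ⥤ D}, Cone d → Prop
  | mk {J : Type (w + 1)} [Category.{w} J] [EssentiallySmall.{w} J] {d : J ⥤ S.C}
      (c : Cone d) (hc : S.IsCone c) : ImageCone S F (F.mapCone c)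

instance hasColimitsOfShape_presheaf (S : Sketch.{w}) (J : Type (w + 1)) [Category.{w} J]
    [EssentiallySmall.{w} J] : HasColimitsOfShape J (S.Cᵒᵖ ⥤ Type w) :=
  hasColimitsOfShape_of_equivalence (equivSmallModel.{w} J).symm

theorem ReflectedYoneda.isColimit {S : Sketch.{w}} (R : S.ReflectedYoneda) {J : Type (w + 1)}
    [Category.{w} J] [EssentiallySmall.{w} J] {d : J ⥤ S.C} (δ : Cocone d) (hδ : S.IsCocone δ) :
    Nonempty (IsColimit (R.functor.mapCocone δ)) := by
  refine ⟨IsColimit.ofExistsUnique fun t => ?_⟩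
  have nat : ∀ {a b : S.C} (f : a ⟶ b), yoneda.map f ≫ R.unit.app b =
      R.unit.app a ≫ (R.functor.map f).hom := fun f => R.unit.naturality f
  have nat' : ∀ {a b : S.C} (f : a ⟶ b) {Z : S.Cᵒᵖ ⥤ Type w} (h : (R.functor.obj b).obj ⟶ Z),
      yoneda.map f ≫ R.unit.app b ≫ h = R.unit.app a ≫ (R.functor.map f).hom ≫ h :=
    fun f _ h => by rw [reassoc_of% (nat f)]
  let t' : Cocone (d ⋙ yoneda) :=
    { pt := t.pt.obj
      ι :=
        { app := fun j => R.unit.app (d.obj j) ≫ (t.ι.app j).hom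
          naturality := fun i j f => by
            have h := congrArg InducedCategory.Hom.hom (t.w f)
            dsimp at h ⊢
            rw [reassoc_of% (nat (d.map f)), Category.comp_id, ← h] } }
  let hc := colimit.isColimit (d ⋙ yoneda)
  obtain ⟨g, hg⟩ := (t.pt.property _ (comparison.mk δ hδ _ hc)).2 (hc.desc t')
  obtain ⟨k, hk⟩ := (R.bijective δ.pt t.pt).2 g
  dsimp only at hg hk
  refine ⟨k, fun j => ?_, fun k' hk' => ?_⟩
  · refine (R.bijective _ _).1 ?_
    have h : yoneda.map (δ.ι.app j) ≫ g = t'.ι.app j := by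
      rw [← hc.fac t' j, ← hg, hc.fac_assoc]; rfl
    rw [← hk] at h
    exact (nat' (δ.ι.app j) k.hom).symm.trans h
  · refine (R.bijective _ _).1 ?_
    refine (t.pt.property _ (comparison.mk δ hδ _ hc)).1 ?_
    dsimp only
    rw [hk, hg]
    refine hc.hom_ext fun j => ?_
    rw [hc.fac_assoc, hc.fac]
    have h := congrArg (fun m : R.functor.obj (d.obj j) ⟶ t.pt => R.unit.app (d.obj j) ≫ m.hom)
      (hk' j)
    exact (nat' (δ.ι.app j) k'.hom).trans h

section Classifier

variable {S : Sketch.{w}} [LocallySmall.{w} S.Hat]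

/-- The functor `J`, with values in the locally small copy of `Hat S`. -/
def ReflectedYoneda.toShrink (R : S.ReflectedYoneda) : S.C ⥤ ShrinkHoms S.Hat :=
  R.functor ⋙ (ShrinkHoms.equivalence S.Hat).functor

/-- The left sketch classifier of `S`: the category `Hat S` (with hom-sets replaced by small
copies), the cones being the images under `J` of the cones of `S`, the cocones being all
colimit cocones. -/
def classifier (R : S.ReflectedYoneda) : Sketch.{w} where
  C := ShrinkHoms S.Hat
  IsCone c := ImageCone S R.toShrink c
  IsCocone c := Nonempty (IsColimit c)

/-- The morphism of sketches `J : S ⟶ classifier`. -/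
def toClassifier (R : S.ReflectedYoneda) : Hom S (classifier R) where
  functor := R.toShrink
  map_cone c hc := ⟨_, R.toShrink.mapCone c, ImageCone.mk c hc, ConeNatIso.refl _⟩
  map_cocone c hc := ⟨_, R.toShrink.mapCocone c, by
    obtain ⟨h⟩ := R.isColimit c hc
    exact ⟨isColimitOfPreserves (ShrinkHoms.equivalence S.Hat).functor h⟩, CoconeNatIso.refl _⟩

end Classifier

/-- The morphism `j : S ⟶ X` exhibits `X` as the left sketch classifier of `S`: the latter exists,
and there is an equivalence in `Skt` between `X` and it which identifies `j` with `J`. -/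
def IsLeftClassifier {S X : Sketch.{w}} (j : S ⟶ X) : Prop :=
  ∃ (_ : LocallySmall.{w} S.Hat) (R : S.ReflectedYoneda)
    (e : Bicategory.Equivalence X (classifier R)), Nonempty (j ≫ e.hom ≅ (toClassifier R : S ⟶ classifier R))

end Sketch

/-! ### The 2-categories of Morita small rounded sketches and of Morita small logoi -/

/-- The objects of `rSkt^M`: the Morita small rounded sketches. -/
structure RSktMObj where
  /-- the underlying sketch -/
  sketch : Sketch.{w}
  isMoritaSmall : sketch.IsMoritaSmall
  isRounded : sketch.IsRounded

/-- The objects of `Log^M`: the Morita small logoi. -/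
structure LogMObj where
  /-- the underlying sketch -/
  sketch : Sketch.{w}
  isMoritaSmall : sketch.IsMoritaSmall
  isLogos : sketch.IsLogos

/-- The full sub-2-category `rSkt^M` of `Skt` on the Morita small rounded sketches. -/
abbrev RSktM : Type (w + 2) :=
  Bicategory.InducedBicategory Sketch.{w} RSktMObj.sketch

/-- The full sub-2-category `Log^M` of `Skt` on the Morita small logoi. -/
abbrev LogM : Type (w + 2) :=
  Bicategory.InducedBicategory Sketch.{w} LogMObj.sketch

/-- The inclusion of `Log^M` into `rSkt^M`. -/
def inclusion : Pseudofunctor LogM.{w} RSktM.{w} :=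
  (StrictPseudofunctor.mk' (B := LogM.{w}) (C := RSktM.{w})
    { obj := fun T => RSktMObj.mk (LogMObj.sketch T) (LogMObj.isMoritaSmall T)
        (LogMObj.isLogos T).isRounded
      map := fun {S T} f => Bicategory.InducedBicategory.mkHom (F := RSktMObj.sketch)
        (Bicategory.InducedBicategory.Hom.hom (F := LogMObj.sketch) (X := S) (Y := T) f)
      map₂ := fun {S T f g} η => Bicategory.InducedBicategory.Hom₂.mk
        (Bicategory.InducedBicategory.Hom₂.hom (F := LogMObj.sketch) (X := S) (Y := T) η)
      map_id := fun _ => rfl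
      map_comp := fun _ _ => rfl }).toPseudofunctor

/-! ### Bireflections -/

section Bireflection

universe w₁ v₁ u₁ w₂ v₂ u₂

open Bicategory

/-- The data exhibiting `U : C ⥤ B` as the inclusion of a bireflective sub-2-category: `U` is
locally an equivalence, and there are a pseudofunctor `reflector` and a pseudonatural transformation
`unit` such that `g ↦ U g ∘ unit` is an equivalence of categories
`C(reflector b, c) ≌ B(b, U c)` (a left biadjoint), and the counit
`reflector (U c) ⟶ c`, the 1-cell corresponding to the identity of `U c`, is an equivalence. -/
structure Bireflection {B : Type u₁} [Bicategory.{w₁, v₁} B] {C : Type u₂}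
    [Bicategory.{w₂, v₂} C] (U : Pseudofunctor C B) where
  /-- the left biadjoint -/
  reflector : Pseudofunctor B C
  /-- the unit of the biadjunction -/
  unit : Pseudofunctor.StrongTrans (Pseudofunctor.id B) (reflector.comp U)
  homEquivalence : ∀ (b : B) (c : C),
    (U.mapFunctor (reflector.obj b) c ⋙ precomp (U.obj c) (unit.app b)).IsEquivalence
  local_equivalence : ∀ c c' : C, (U.mapFunctor c c').IsEquivalence
  counit_equivalence : ∀ c : C, ∃ e : Bicategory.Equivalence (reflector.obj (U.obj c)) c,
    Nonempty (unit.app (U.obj c) ≫ U.map e.hom ≅ 𝟙 (U.obj c))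

end Bireflection

end LogosTheory

end

/-! A presheaf on `S` is orthogonal to the comparison maps exactly when it turns specified cocones
into limit cones, i.e. when it is a left model of `S` in the cocomplete category `(Type w)ᵒᵖ`. A
Morita equivalence `F : D ⟶ S` therefore restricts to an equivalence `S.Hat ≌ D.Hat`
(`isEquivalence_hatRestriction`). For small `D`, `D.Hat` is cut out by a set of maps in a locally
presentable presheaf category, so it is reflective, cocomplete and locally small. Cocompleteness and
local smallness pass to `S.Hat`, and the classifier of `S` is a left sketch.

The nerve of the composite of `F` with `J` is this equivalence followed by the inclusion of `D.Hat`.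
Hence the composite is dense, and a model of `D` in a cocomplete category, whose nerve takes local
values, extends to a left adjoint on `S.Hat`. Thus `J` is itself a Morita equivalence
(`isMoritaEquivalence_toClassifier`).

Besides providing `J`, roundedness serves only to make the specified cones of the classifier limit
cones, so that it is a logos. The rest is formal: 1-cells and 2-cells from the classifier to a left
sketch are determined up to isomorphism, respectively uniquely, by restriction along `η`. This
yields the pseudofunctor, the biadjunction and the extension property for all logoi. If the sketch
is already left, its identity extends along `η`, and the extension is inverse to `η`. -/

noncomputable section

namespace LogosTheory

/-! ### Orthogonality to comparison maps as a limit condition -/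

open Opposite

/-- By Yoneda, maps out of `yoneda.obj δ.pt` are elements of `P` at `δ.pt`, and maps out of `c.pt`
are compatible families of elements along the diagram. Precomposition with the comparison map sends
an element to its family of restrictions. -/
theorem bijective_desc_comp_iff {J : Type u'} [Category.{v'} J] {C : Type u} [Category.{w} C]
    {d : J ⥤ C} (δ : Cocone d) {c : Cocone (d ⋙ yoneda)} (hc : IsColimit c)
    (P : Cᵒᵖ ⥤ Type w) :
    (Function.Bijective fun g : yoneda.obj δ.pt ⟶ P => hc.desc (yoneda.mapCocone δ) ≫ g) ↔
      Nonempty (IsLimit (P.mapCone δ.op)) := by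
  rw [Types.isLimit_iff, Function.bijective_iff_existsUnique]
  have key : ∀ (g : c.pt ⟶ P) (x : P.obj (op δ.pt)),
      hc.desc (yoneda.mapCocone δ) ≫ yonedaEquiv.symm x = g ↔
        ∀ j : Jᵒᵖ, (P.mapCone δ.op).π.app j x = yonedaEquiv (c.ι.app j.unop ≫ g) := by
    intro g x
    have e : ∀ j : J, c.ι.app j ≫ hc.desc (yoneda.mapCocone δ) ≫ yonedaEquiv.symm x =
        yoneda.map (δ.ι.app j) ≫ yonedaEquiv.symm x := fun j => by
      rw [hc.fac_assoc]; rfl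
    have e' : ∀ j : J, yonedaEquiv (yoneda.map (δ.ι.app j) ≫ yonedaEquiv.symm x) =
        P.map (δ.ι.app j).op x := fun j => by
      rw [← yonedaEquiv_naturality, Equiv.apply_symm_apply]
    constructor
    · rintro rfl j
      rw [e, e']; rfl
    · intro h
      refine hc.hom_ext fun j => yonedaEquiv.injective ?_
      rw [e, e', ← h (op j)]; rfl
  constructor
  · intro h s hs
    let t : Cocone (d ⋙ yoneda) :=
      { pt := P
        ι :=
          { app := fun j => yonedaEquiv.symm (s (op j))
            naturality := fun i j f => by
              refine yonedaEquiv.injective ?_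
              dsimp
              rw [← yonedaEquiv_naturality, Equiv.apply_symm_apply, Category.comp_id,
                Equiv.apply_symm_apply]
              exact hs f.op } }
    have ht : ∀ j : Jᵒᵖ, yonedaEquiv (c.ι.app j.unop ≫ hc.desc t) = s j := fun j => by
      rw [hc.fac]; exact Equiv.apply_symm_apply _ _
    obtain ⟨g, hg, hu⟩ := h (hc.desc t)
    refine ⟨yonedaEquiv g, fun j => ?_, fun y hy => ?_⟩
    · exact ((key (hc.desc t) (yonedaEquiv g)).1 (by simpa using hg) j).trans (ht j)
    · rw [← hu (yonedaEquiv.symm y) ((key _ _).2 fun j => (hy j).trans (ht j).symm),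
        Equiv.apply_symm_apply]
  · intro h g
    obtain ⟨x, hx, hu⟩ := h (fun j => yonedaEquiv (c.ι.app j.unop ≫ g)) (by
      intro i j f
      have e : yoneda.map (d.map f.unop) ≫ c.ι.app i.unop ≫ g = c.ι.app j.unop ≫ g := by
        rw [← c.w f.unop, Category.assoc]; rfl
      exact (yonedaEquiv_naturality (c.ι.app i.unop ≫ g) (d.map f.unop)).trans
        (congrArg yonedaEquiv e))
    refine ⟨yonedaEquiv.symm x, (key g x).2 hx, fun y hy => ?_⟩
    rw [← hu (yonedaEquiv y) ((key g _).1 (by simpa using hy)), Equiv.symm_apply_apply]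

theorem hasColimitsOfShape_of_essentiallySmall {E : Type u} [Category.{v} E]
    [HasColimitsOfSize.{w, w} E] (J : Type u') [Category.{v'} J] [EssentiallySmall.{w} J] :
    HasColimitsOfShape J E :=
  hasColimitsOfShape_of_equivalence (equivSmallModel.{w} J).symm

namespace Sketch

/-- A functor on a sketch is a left model if it sends the specified cocones to colimit cocones. -/
def IsLeftModel (S : Sketch.{w}) {E : Type u} [Category.{v} E] (F : S.C ⥤ E) : Prop :=
  ∀ {J : Type (w + 1)} [Category.{w} J] [EssentiallySmall.{w} J] {d : J ⥤ S.C} (δ : Cocone d),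
    S.IsCocone δ → Nonempty (IsColimit (F.mapCocone δ))

theorem isLocal_iff {S : Sketch.{w}} {P : S.Cᵒᵖ ⥤ Type w} :
    (comparison S).isLocal P ↔
      ∀ {J : Type (w + 1)} [Category.{w} J] [EssentiallySmall.{w} J] {d : J ⥤ S.C}
        (δ : Cocone d), S.IsCocone δ → Nonempty (IsLimit (P.mapCone δ.op)) := by
  constructor
  · intro h J _ _ d δ hδ
    exact (bijective_desc_comp_iff δ (colimit.isColimit (d ⋙ yoneda)) P).1
      (h _ (comparison.mk δ hδ _ _))
  · rintro h _ _ _ ⟨δ, hδ, c, hc⟩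
    exact (bijective_desc_comp_iff δ hc P).2 (h δ hδ)

theorem nonempty_isColimit_rightOp_iff {J : Type u'} [Category.{v'} J] {C : Type u}
    [Category.{v} C] {E : Type*} [Category* E] {d : J ⥤ C} (δ : Cocone d) (P : Cᵒᵖ ⥤ E) :
    Nonempty (IsColimit (P.rightOp.mapCocone δ)) ↔ Nonempty (IsLimit (P.mapCone δ.op)) := by
  constructor
  · rintro ⟨h⟩
    exact ⟨isLimitConeLeftOpOfCocone _ h⟩
  · rintro ⟨h⟩
    exact ⟨isColimitCoconeRightOpOfCone _ h⟩

/-- This makes local presheaves accessible to Morita equivalences, which are tested only on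
covariant functors into left sketches. -/
theorem isLeftModel_rightOp_iff {S : Sketch.{w}} {P : S.Cᵒᵖ ⥤ Type w} :
    S.IsLeftModel P.rightOp ↔ (comparison S).isLocal P := by
  rw [isLocal_iff]
  constructor
  · intro h J _ _ d δ hδ
    exact (nonempty_isColimit_rightOp_iff δ P).1 (h δ hδ)
  · intro h J _ _ d δ hδ
    exact (nonempty_isColimit_rightOp_iff δ P).2 (h δ hδ)

/-- Homming out of a colimit gives a limit. Consequently the nerve of a left model takes values in
local presheaves. -/
theorem isLocal_of_isLeftModel {S : Sketch.{w}} {E : Type u} [Category.{w} E] {F : S.C ⥤ E}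
    (hF : S.IsLeftModel F) (X : E) : (comparison S).isLocal (F.op ⋙ yoneda.obj X) := by
  rw [isLocal_iff]
  intro J _ _ d δ hδ
  obtain ⟨h⟩ := hF δ hδ
  exact ⟨isLimitOfPreserves (yoneda.obj X) (show IsLimit (F.op.mapCone δ.op) from h.op)⟩

theorem IsLeftModel.of_iso {S : Sketch.{w}} {E : Type u} [Category.{v} E] {F G : S.C ⥤ E}
    (hF : S.IsLeftModel F) (e : F ≅ G) : S.IsLeftModel G := fun δ hδ => by
  obtain ⟨h⟩ := hF δ hδ
  exact ⟨IsColimit.mapCoconeEquiv e h⟩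

end Sketch

theorem CoconeNatIso.isColimit {J : Type u'} [Category.{v'} J] {C : Type u} [Category.{v} C]
    {d d' : J ⥤ C} {c : Cocone d} {c' : Cocone d'} (h : CoconeNatIso c c')
    (hc' : IsColimit c') : Nonempty (IsColimit c) := by
  obtain ⟨α, e, h⟩ := h
  refine ⟨(IsColimit.precomposeHomEquiv α c').symm hc' |>.ofIsoColimit ?_⟩
  exact Cocone.ext e.symm fun j => by
    dsimp
    rw [← h j, Category.assoc, e.hom_inv_id]
    exact Category.comp_id _

theorem ConeNatIso.trans {J : Type u'} [Category.{v'} J] {C : Type u} [Category.{v} C]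
    {d d' d'' : J ⥤ C} {c : Cone d} {c' : Cone d'} {c'' : Cone d''} (h : ConeNatIso c c')
    (h' : ConeNatIso c' c'') : ConeNatIso c c'' := by
  obtain ⟨α, e, h⟩ := h
  obtain ⟨β, f, h'⟩ := h'
  exact ⟨α ≪≫ β, e ≪≫ f, fun j => by simp [h', reassoc_of% h]⟩

theorem ConeNatIso.of_functor_iso {J : Type u'} [Category.{v'} J] {C : Type u} [Category.{v} C]
    {E : Type*} [Category* E] {G H : C ⥤ E} (e : G ≅ H) {d : J ⥤ C} (c : Cone d) :
    ConeNatIso (G.mapCone c) (H.mapCone c) :=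
  ⟨Functor.isoWhiskerLeft d e, e.app c.pt, fun j => (e.hom.naturality (c.π.app j)).symm⟩

theorem CoconeNatIso.symm {J : Type u'} [Category.{v'} J] {C : Type u} [Category.{v} C]
    {d d' : J ⥤ C} {c : Cocone d} {c' : Cocone d'} (h : CoconeNatIso c c') :
    CoconeNatIso c' c := by
  obtain ⟨α, e, h⟩ := h
  exact ⟨α.symm, e.symm, fun j => by simp [← cancel_mono e.hom, h]⟩

/-! ### Left models as morphisms of sketches, and Morita invariance of `Hat` -/

namespace Sketch

theorem Hom.isLeftModel {S T : Sketch.{w}} (F : Hom S T) {E : Type u} [Category.{v} E]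
    {G : T.C ⥤ E} (hG : T.IsLeftModel G) : S.IsLeftModel (F.functor ⋙ G) := fun δ hδ => by
  obtain ⟨d', c', hc', α, e, h⟩ := F.map_cocone δ hδ
  obtain ⟨hl⟩ := hG c' hc'
  refine CoconeNatIso.isColimit (c' := G.mapCocone c')
    ⟨Functor.associator _ _ _ ≪≫ Functor.isoWhiskerRight α G, G.mapIso e, fun j => ?_⟩ hl
  have h1 := congrArg G.map (h j)
  simpa using h1

theorem IsLeft.isLeftModel_functor {S T : Sketch.{w}} (hT : T.IsLeft) (F : Hom S T) :
    S.IsLeftModel F.functor := fun δ hδ => by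
  obtain ⟨d', c', hc', h⟩ := F.map_cocone δ hδ
  exact h.isColimit ((hT.isCocone_iff c').1 hc').some

/-- A category as a sketch all of whose cones are specified, the specified cocones being the
colimit cocones. -/
def ofCategory (E : Type (w + 1)) [Category.{w} E] : Sketch.{w} where
  C := E
  IsCone _ := True
  IsCocone c := Nonempty (IsColimit c)

theorem isLeft_ofCategory (E : Type (w + 1)) [Category.{w} E] [h : HasColimitsOfSize.{w, w} E] :
    (ofCategory E).IsLeft :=
  ⟨h, fun _ => Iff.rfl⟩

/-- A left model with values in `E` as a morphism of sketches. -/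
def IsLeftModel.hom {S : Sketch.{w}} {E : Type (w + 1)} [Category.{w} E] {F : S.C ⥤ E}
    (hF : S.IsLeftModel F) : S ⟶ ofCategory E :=
  show Hom S (ofCategory E) from
  { functor := F
    map_cone := fun c _ => ⟨_, F.mapCone c, trivial, ConeNatIso.refl _⟩
    map_cocone := fun c hc => ⟨_, F.mapCocone c, hF c hc, CoconeNatIso.refl _⟩ }

section Restriction

variable {S T : Sketch.{w}} {F : S ⟶ T}

/-- Since every cone of `ofCategory E` is specified, any left model is a morphism into it, whatever
it does to cones. The Morita property can thus be applied to bare functors. -/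
theorem IsMoritaEquivalence.bijective_whiskerLeft (hF : IsMoritaEquivalence F)
    {E : Type (w + 1)} [Category.{w} E] [HasColimitsOfSize.{w, w} E] {G H : T.C ⥤ E}
    (hG : T.IsLeftModel G) (hH : T.IsLeftModel H) :
    Function.Bijective fun α : G ⟶ H => Functor.whiskerLeft (functor F) α := by
  have := hF _ (isLeft_ofCategory E)
  exact (Functor.FullyFaithful.ofFullyFaithful
    (Bicategory.precomp (ofCategory E) F)).map_bijective hG.hom hH.hom

theorem IsMoritaEquivalence.exists_extension (hF : IsMoritaEquivalence F)
    {E : Type (w + 1)} [Category.{w} E] [HasColimitsOfSize.{w, w} E] {G : S.C ⥤ E}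
    (hG : S.IsLeftModel G) :
    ∃ H : T.C ⥤ E, T.IsLeftModel H ∧ Nonempty (functor F ⋙ H ≅ G) := by
  have := hF _ (isLeft_ofCategory E)
  let e := (Bicategory.precomp (ofCategory E) F).objObjPreimageIso hG.hom
  exact ⟨functor ((Bicategory.precomp (ofCategory E) F).objPreimage hG.hom),
    (isLeft_ofCategory E).isLeftModel_functor _,
    ⟨{ hom := natTrans e.hom, inv := natTrans e.inv,
       hom_inv_id := e.hom_inv_id, inv_hom_id := e.inv_hom_id }⟩⟩

theorem isLocal_comp (F : S ⟶ T) {P : T.Cᵒᵖ ⥤ Type w} (hP : (comparison T).isLocal P) :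
    (comparison S).isLocal ((functor F).op ⋙ P) := by
  rw [← isLeftModel_rightOp_iff] at hP ⊢
  exact Hom.isLeftModel F hP

/-- Restriction of local presheaves along a morphism of sketches. -/
def hatRestriction (F : S ⟶ T) : T.Hat ⥤ S.Hat :=
  (comparison S).isLocal.lift
    ((comparison T).isLocal.ι ⋙ (Functor.whiskeringLeft _ _ _).obj (functor F).op)
    fun P => isLocal_comp F P.property

/-- The Morita property is applied with `E = (Type w)ᵒᵖ`. Passing to `rightOp` reverses natural
transformations, which is why `Q` and `P` appear swapped. -/
theorem IsMoritaEquivalence.isEquivalence_hatRestriction (hF : IsMoritaEquivalence F) :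
    (hatRestriction F).IsEquivalence where
  faithful := ⟨fun {P Q f g} h => by
    have h' : Functor.whiskerLeft (functor F) (NatTrans.rightOp f.hom) =
        Functor.whiskerLeft (functor F) (NatTrans.rightOp g.hom) := by
      ext s
      exact congrArg (fun k => (k.hom.app (op s)).op) h
    have h2 := (hF.bijective_whiskerLeft (isLeftModel_rightOp_iff.2 Q.property)
      (isLeftModel_rightOp_iff.2 P.property)).1 h'
    refine ObjectProperty.hom_ext _ (NatTrans.ext (funext fun s => ?_))
    exact congrArg (fun k => (k.app s.unop).unop) h2⟩
  full := ⟨fun {P Q} f => by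
    obtain ⟨g, hg⟩ := (hF.bijective_whiskerLeft (isLeftModel_rightOp_iff.2 Q.property)
      (isLeftModel_rightOp_iff.2 P.property)).2 (NatTrans.rightOp f.hom)
    refine ⟨ObjectProperty.homMk (NatTrans.removeRightOp g), ?_⟩
    refine ObjectProperty.hom_ext _ (NatTrans.ext (funext fun s => ?_))
    exact congrArg (fun k => (k.app s.unop).unop) hg⟩
  essSurj := ⟨fun P => by
    obtain ⟨H, hH, ⟨e⟩⟩ := hF.exists_extension (isLeftModel_rightOp_iff.2 P.property)
    refine ⟨⟨H.leftOp, isLeftModel_rightOp_iff.1 (hH.of_iso H.leftOpRightOpIso.symm)⟩, ⟨?_⟩⟩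
    refine (comparison S).isLocal.isoMk (NatIso.ofComponents
      (fun s => (e.app s.unop).unop.symm) fun {a b} f => ?_)
    exact (congrArg Quiver.Hom.unop (e.inv.naturality f.unop)).symm⟩

end Restriction

end Sketch

/-! ### Small orthogonality classes: reflectivity, cocompleteness, local smallness -/

/-- Every object of a locally presentable category is presentable, and a set of objects admits a
common regular cardinal of presentability. -/
theorem isRightAdjoint_ι_isLocal_ofHoms {C : Type u} [Category.{v} C]
    [IsLocallyPresentable.{w} C] {ι : Type w} {A B : ι → C} (f : ∀ i, A i ⟶ B i) :
    (MorphismProperty.ofHoms f).isLocal.ι.IsRightAdjoint := by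
  have hpres : ∀ X : C, ∃ (κ : Cardinal.{w}) (_ : Fact κ.IsRegular),
      IsCardinalPresentable X κ := fun X =>
    (inferInstance : IsPresentable.{w} X).exists_cardinal
  choose κ hκ hX using hpres
  -- The bound is stated for types, so each cardinal is represented by its initial ordinal. The sum
  -- indexes sources and targets together.
  obtain ⟨κ', h₁, h₂⟩ := HasCardinalLT.exists_regular_cardinal_forall.{w}
    (Sum.elim (fun i : ι => (κ (A i)).ord.ToType) (fun i : ι => (κ (B i)).ord.ToType))
  have : Fact κ'.IsRegular := ⟨h₁⟩
  obtain ⟨κ₀, _, _⟩ := IsLocallyPresentable.exists_cardinal.{w} C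
  refine MorphismProperty.isRightAdjoint_ι_isLocal.{w} _ κ' ?_
  rintro _ _ _ ⟨i⟩
  have := hX (A i)
  have := hX (B i)
  exact ⟨isCardinalPresentable_of_le (A i)
      (le_of_lt (by simpa [hasCardinalLT_iff_cardinal_mk_lt] using h₂ (Sum.inl i))),
    isCardinalPresentable_of_le (B i)
      (le_of_lt (by simpa [hasCardinalLT_iff_cardinal_mk_lt] using h₂ (Sum.inr i)))⟩

theorem isLocallyPresentable_presheaf (C : Type u) [Category.{v} C] [EssentiallySmall.{w} C] :
    IsLocallyPresentable.{w} (Cᵒᵖ ⥤ Type w) :=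
  ((equivSmallModel.{w} C).op.congrLeft (E := Type w)).symm.isLocallyPresentable

theorem CoconeNatIso.isLimit_mapCone_op_iff {J : Type u'} [Category.{v'} J] {C : Type u}
    [Category.{v} C] {E : Type*} [Category* E] {d d' : J ⥤ C} {c : Cocone d} {c' : Cocone d'}
    (h : CoconeNatIso c c') (P : Cᵒᵖ ⥤ E) :
    Nonempty (IsLimit (P.mapCone c.op)) ↔ Nonempty (IsLimit (P.mapCone c'.op)) := by
  have key : ∀ {d d' : J ⥤ C} {c : Cocone d} {c' : Cocone d'}, CoconeNatIso c c' →
      Nonempty (IsColimit (P.rightOp.mapCocone c')) →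
      Nonempty (IsColimit (P.rightOp.mapCocone c)) := by
    rintro d d' c c' ⟨α, e, h⟩ ⟨hc⟩
    refine CoconeNatIso.isColimit (c' := P.rightOp.mapCocone c') ⟨Functor.isoWhiskerRight α P.rightOp,
      P.rightOp.mapIso e, fun j => ?_⟩ hc
    have h1 := congrArg P.rightOp.map (h j)
    simp only [Functor.map_comp] at h1
    exact h1
  rw [← Sketch.nonempty_isColimit_rightOp_iff, ← Sketch.nonempty_isColimit_rightOp_iff]
  exact ⟨key h.symm, key h⟩

theorem isLimit_mapCone_op_whisker_iff {J : Type u'} [Category.{v'} J] {C : Type u}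
    [Category.{v} C] {E : Type*} [Category* E] {d : J ⥤ C} (c : Cocone d)
    {K : Type*} [Category* K] (e : K ≌ J) (P : Cᵒᵖ ⥤ E) :
    Nonempty (IsLimit (P.mapCone (c.whisker e.functor).op)) ↔
      Nonempty (IsLimit (P.mapCone c.op)) :=
  ⟨fun ⟨h⟩ => ⟨(IsLimit.whiskerEquivalenceEquiv e.op).symm h⟩,
    fun ⟨h⟩ => ⟨IsLimit.whiskerEquivalenceEquiv e.op h⟩⟩

namespace Sketch

/-- The limit condition is invariant under natural isomorphism of cocones and equivalence of shapes,
so a set of representatives defines the same orthogonality class. -/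
theorem IsSmall.exists_isLocal_eq {D : Sketch.{w}} (hD : D.IsSmall) :
    ∃ (ι : Type w) (A B : ι → D.Cᵒᵖ ⥤ Type w) (f : ∀ i, A i ⟶ B i),
      (comparison D).isLocal = (MorphismProperty.ofHoms f).isLocal := by
  obtain ⟨ι, K, _, f, γ, h⟩ := hD.small_cocones
  -- The family given by smallness may contain cocones that represent no specified one.
  -- Orthogonality to those would be too strong, so they are discarded.
  let good (i : ι) : Prop := ∃ (J : Type (w + 1)) (_ : Category.{w} J)
    (_ : EssentiallySmall.{w} J) (d : J ⥤ D.C) (c : Cocone d) (_ : D.IsCocone c) (e : K i ≌ J),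
      CoconeNatIso (γ i) (c.whisker e.functor)
  refine ⟨{i // good i}, fun i => colimit (f i.1 ⋙ yoneda), fun i => yoneda.obj (γ i.1).pt,
    fun i => (colimit.isColimit (f i.1 ⋙ yoneda)).desc (yoneda.mapCocone (γ i.1)), ?_⟩
  ext P
  rw [isLocal_iff]
  constructor
  · rintro hP _ _ _ ⟨i, J, _, _, d, c, hc, e, hi⟩
    exact (bijective_desc_comp_iff _ _ P).2 ((hi.isLimit_mapCone_op_iff P).2
      ((isLimit_mapCone_op_whisker_iff c e P).2 (hP c hc)))
  · intro hP J _ _ d c hc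
    obtain ⟨i, e, hi⟩ := h c hc
    exact (isLimit_mapCone_op_whisker_iff c e P).1 ((hi.isLimit_mapCone_op_iff P).1
      ((bijective_desc_comp_iff _ _ P).1
        (hP _ (MorphismProperty.ofHoms.mk (⟨i, J, _, _, d, c, hc, e, hi⟩ : {i // good i})))))

theorem IsSmall.isRightAdjoint_ι {D : Sketch.{w}} (hD : D.IsSmall) :
    (comparison D).isLocal.ι.IsRightAdjoint := by
  obtain ⟨ι, A, B, f, h⟩ := hD.exists_isLocal_eq
  have := hD.essentiallySmall
  have := isLocallyPresentable_presheaf.{w} D.C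
  rw [h]
  exact isRightAdjoint_ι_isLocal_ofHoms f

theorem IsSmall.hasColimits_hat {D : Sketch.{w}} (hD : D.IsSmall) :
    HasColimitsOfSize.{w, w} D.Hat := by
  have := hD.isRightAdjoint_ι
  let : Reflective (comparison D).isLocal.ι := ⟨_, Adjunction.ofIsRightAdjoint _⟩
  exact hasColimits_of_reflective (comparison D).isLocal.ι

theorem IsSmall.locallySmall_hat {D : Sketch.{w}} (hD : D.IsSmall) :
    LocallySmall.{w} D.Hat := by
  have := hD.essentiallySmall
  have := isLocallyPresentable_presheaf.{w} D.C
  -- `κ₀` serves only to obtain local smallness of the presheaf category.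
  obtain ⟨κ₀, _, _⟩ := IsLocallyPresentable.exists_cardinal.{w} (D.Cᵒᵖ ⥤ Type w)
  exact locallySmall_of_faithful (comparison D).isLocal.ι

theorem IsMoritaSmall.locallySmall_hat {S : Sketch.{w}} (hS : S.IsMoritaSmall) :
    LocallySmall.{w} S.Hat := by
  obtain ⟨D, F, hD, hF⟩ := hS
  have := hD.locallySmall_hat
  have := hF.isEquivalence_hatRestriction
  exact locallySmall_of_faithful (hatRestriction F)

/-- Colimits come from `D.Hat`; no reflection of arbitrary presheaves on the possibly large `S` is
needed. -/
theorem IsMoritaSmall.hasColimits_hat {S : Sketch.{w}} (hS : S.IsMoritaSmall) :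
    HasColimitsOfSize.{w, w} S.Hat := by
  obtain ⟨D, F, hD, hF⟩ := hS
  have := hD.hasColimits_hat
  have := hF.isEquivalence_hatRestriction
  exact Adjunction.has_colimits_of_equivalence (hatRestriction F)

theorem isLeft_classifier {S : Sketch.{w}} (hS : S.IsMoritaSmall) [LocallySmall.{w} S.Hat]
    (R : S.ReflectedYoneda) : (classifier R).IsLeft where
  cocomplete := by
    have := hS.hasColimits_hat
    have h : HasColimitsOfSize.{w, w} (ShrinkHoms.{w + 1} S.Hat) :=
      Adjunction.has_colimits_of_equivalence (ShrinkHoms.equivalence.{w} S.Hat).inverse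
    exact h
  isCocone_iff _ := Iff.rfl

end Sketch

/-! ### Nerves, density and extension to left adjoints -/

/-- Functors corepresenting naturally isomorphic functors are isomorphic. -/
def isoOfHomEquiv {C : Type u} [Category.{v} C] {M : Type u'} [Category.{v'} M] (F G : C ⥤ M)
    (e : ∀ (c : C) (m : M), (F.obj c ⟶ m) ≃ (G.obj c ⟶ m))
    (nat₁ : ∀ (c : C) {m m' : M} (f : F.obj c ⟶ m) (g : m ⟶ m'), e c m' (f ≫ g) = e c m f ≫ g)
    (nat₂ : ∀ {c c' : C} (k : c ⟶ c') {m : M} (f : F.obj c' ⟶ m),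
      e c m (F.map k ≫ f) = G.map k ≫ e c' m f) : F ≅ G :=
  NatIso.ofComponents
    (fun c =>
      { hom := (e c _).symm (𝟙 _)
        inv := e c _ (𝟙 _)
        hom_inv_id := (e c _).injective (by
          rw [nat₁, Equiv.apply_symm_apply, Category.id_comp])
        inv_hom_id := by
          rw [← nat₁, Category.id_comp, Equiv.apply_symm_apply] })
    fun {c c'} k => (e c _).injective (by
      refine (nat₂ k _).trans (Eq.trans ?_ (nat₁ c _ _).symm)
      rw [Equiv.apply_symm_apply, Equiv.apply_symm_apply, Category.id_comp, Category.comp_id])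

section Nerve

variable {C : Type u} [Category.{w} C] {B : Type u'} [Category.{w} B]

/-- The functor sending `X` to the presheaf of morphisms from `j` to `X`. -/
abbrev nerve (j : C ⥤ B) : B ⥤ Cᵒᵖ ⥤ Type w :=
  yoneda ⋙ (Functor.whiskeringLeft _ _ _).obj j.op

/-- The cocone with point `X` over the canonical diagram of the objects `j c` over `X`. -/
def canonicalCocone (j : C ⥤ B) (X : B) : Cocone (CostructuredArrow.proj j X ⋙ j) where
  pt := X
  ι :=
    { app := fun p => p.hom
      naturality := fun _ _ f => (CostructuredArrow.w f).trans (Category.comp_id _).symm }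

/-- A cocone on the canonical diagram with point `Z` is the same as a natural transformation from
the nerve of `Y` to that of `Z`; full faithfulness turns it into a unique morphism `Y ⟶ Z`. -/
theorem nonempty_isColimit_canonicalCocone {j : C ⥤ B} (h : (nerve j).FullyFaithful) (Y : B) :
    Nonempty (IsColimit (canonicalCocone j Y)) := by
  refine ⟨IsColimit.ofExistsUnique fun s => ?_⟩
  let φ : (nerve j).obj Y ⟶ (nerve j).obj s.pt :=
    { app := fun X => ↾fun x => s.ι.app (CostructuredArrow.mk (Y := X.unop) x)
      naturality := fun X₁ X₂ f => by
        ext x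
        let α : CostructuredArrow.mk (j.map f.unop ≫ x) ⟶ CostructuredArrow.mk x :=
          CostructuredArrow.homMk f.unop
        exact (s.w α).symm }
  refine ⟨h.preimage φ, fun p => ?_, fun m hm => h.map_injective ?_⟩
  · exact ConcreteCategory.congr_hom (NatTrans.congr_app (h.map_preimage φ) (op p.left)) p.hom
  · refine Eq.trans ?_ (h.map_preimage φ).symm
    ext X x
    exact hm (CostructuredArrow.mk (Y := X.unop) x)

/-- The hypothesis presents `H` pointwise as the left Kan extension of its restriction along `j`. -/
theorem bijective_whiskerLeft_of_isColimit {E : Type*} [Category* E] {j : C ⥤ B}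
    {H K : B ⥤ E} (hH : ∀ X : B, Nonempty (IsColimit (H.mapCocone (canonicalCocone j X)))) :
    Function.Bijective fun α : H ⟶ K => Functor.whiskerLeft j α := by
  have hext : ∀ {X : B} {Z : E} {a b : H.obj X ⟶ Z},
      (∀ (c : C) (p : j.obj c ⟶ X), H.map p ≫ a = H.map p ≫ b) → a = b :=
    fun {X Z a b} h => (hH X).some.hom_ext fun p => h p.left p.hom
  constructor
  · intro α β h
    ext X
    refine hext fun c p => ?_
    rw [α.naturality, β.naturality]
    exact congrArg (· ≫ K.map p) (NatTrans.congr_app h c)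
  · intro γ
    have hdesc : ∀ X : B, ∃ m : H.obj X ⟶ K.obj X, ∀ (c : C) (p : j.obj c ⟶ X),
        H.map p ≫ m = γ.app c ≫ K.map p := fun X => by
      let t : Cocone ((CostructuredArrow.proj j X ⋙ j) ⋙ H) :=
        { pt := K.obj X
          ι :=
            { app := fun p => γ.app p.left ≫ K.map p.hom
              naturality := fun p q f => by
                have h1 := γ.naturality f.left
                have h2 := congrArg K.map (CostructuredArrow.w f)
                rw [Functor.map_comp] at h2
                refine Eq.trans ?_ (Category.comp_id _).symm
                rw [← h2]
                refine (Category.assoc _ _ _).symm.trans (Eq.trans ?_ (Category.assoc _ _ _))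
                exact congrArg (· ≫ K.map q.hom) h1 } }
      exact ⟨(hH X).some.desc t, fun c p => (hH X).some.fac t (CostructuredArrow.mk p)⟩
    choose m hm using hdesc
    refine ⟨{ app := m, naturality := fun X Y f => hext fun c p => ?_ }, ?_⟩
    · rw [← Category.assoc, ← H.map_comp, hm, ← Category.assoc, hm, K.map_comp, Category.assoc]
    · ext c
      simpa using hm _ c (𝟙 _)

/-- The nerve of `G` has a left adjoint `L` on presheaves. By `hG` it factors through the full
embedding `nerve j` as a functor `T`, and `T` then has left adjoint `nerve j ⋙ L`. -/
theorem exists_isLeftAdjoint_extension [EssentiallySmall.{w} C] (j : C ⥤ B)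
    (hj : (nerve j).FullyFaithful) {M : Type*} [Category.{w} M] [HasColimitsOfSize.{w, w} M]
    (G : C ⥤ M) (hG : ∀ m : M, (nerve j).essImage ((nerve G).obj m)) :
    ∃ H : B ⥤ M, H.IsLeftAdjoint ∧ Nonempty (j ⋙ H ≅ G) := by
  have := hj.full
  have := hj.faithful
  have := isLocallyPresentable_presheaf.{w} C
  obtain ⟨κ₀, _, _⟩ := IsLocallyPresentable.exists_cardinal.{w} (Cᵒᵖ ⥤ Type w)
  have : ∀ P : Cᵒᵖ ⥤ Type w, HasColimitsOfShape (CostructuredArrow uliftYoneda.{w} P) M :=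
    fun P => hasColimitsOfShape_of_essentiallySmall.{w} _
  let L : (Cᵒᵖ ⥤ Type w) ⥤ M := uliftYoneda.{w}.leftKanExtension G
  let adj : L ⊣ Presheaf.restrictedULiftYoneda.{w} G :=
    Presheaf.uliftYonedaAdjunction.{w} L (uliftYoneda.{w}.leftKanExtensionUnit G)
  let i : Presheaf.restrictedULiftYoneda.{w} G ≅ nerve G :=
    NatIso.ofComponents fun m => NatIso.ofComponents fun c => Equiv.ulift.toIso
  let adj' : L ⊣ nerve G := adj.ofNatIsoRight i
  let T : M ⥤ B := Functor.essImage.liftFunctor (nerve G) (nerve j) hG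
  let iT : T ⋙ nerve j ≅ nerve G := Functor.essImage.liftFunctorCompIso _ _ hG
  let adjT : nerve j ⋙ L ⊣ T := adj'.restrictFullyFaithful hj (Functor.FullyFaithful.id M)
    (Iso.refl _) (Functor.leftUnitor _ ≪≫ iT.symm)
  refine ⟨nerve j ⋙ L, ⟨_, ⟨adjT⟩⟩, ⟨?_⟩⟩
  -- As `j` need not be fully faithful, the nerve of `j c` need not be representable. The comparison
  -- with `G c` goes through `T`: maps `j c ⟶ T m` are the value at `c` of the nerve of `T m`, hence
  -- maps `G c ⟶ m`.
  let homEquiv (c : C) (m : M) : (L.obj ((nerve j).obj (j.obj c)) ⟶ m) ≃ (G.obj c ⟶ m) :=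
    (adjT.homEquiv (j.obj c) m).trans ((iT.app m).app (op c)).toEquiv
  have nat₁ : ∀ (c : C) {m m' : M} (f : L.obj ((nerve j).obj (j.obj c)) ⟶ m) (g : m ⟶ m'),
      homEquiv c m' (f ≫ g) = homEquiv c m f ≫ g := fun c m m' f g => by
    dsimp only [homEquiv, Equiv.trans_apply]
    rw [adjT.homEquiv_naturality_right]
    exact ConcreteCategory.congr_hom (NatTrans.congr_app (iT.hom.naturality g) (op c)) _
  have nat₂ : ∀ {c c' : C} (k : c ⟶ c') {m : M} (f : L.obj ((nerve j).obj (j.obj c')) ⟶ m),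
      homEquiv c m (L.map ((nerve j).map (j.map k)) ≫ f) = G.map k ≫ homEquiv c' m f :=
    fun {c c'} k m f => by
    dsimp only [homEquiv, Equiv.trans_apply]
    rw [show L.map ((nerve j).map (j.map k)) = (nerve j ⋙ L).map (j.map k) from rfl,
      adjT.homEquiv_naturality_left]
    exact ConcreteCategory.congr_hom ((iT.app m).hom.naturality k.op) _
  exact isoOfHomEquiv (j ⋙ nerve j ⋙ L) G homEquiv nat₁ nat₂

end Nerve

/-! ### The classifier map is a Morita equivalence -/

namespace Sketch

section

variable {S : Sketch.{w}}

/-- Morphisms from `J s` to a local presheaf are elements of the presheaf at `s`. -/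
def ReflectedYoneda.homEquiv (R : S.ReflectedYoneda) (s : S.C) (P : S.Hat) :
    (R.functor.obj s ⟶ P) ≃ P.obj.obj (op s) :=
  (Equiv.ofBijective _ (R.bijective s P)).trans yonedaEquiv

theorem ReflectedYoneda.homEquiv_comp (R : S.ReflectedYoneda) {s : S.C} {P Q : S.Hat}
    (f : R.functor.obj s ⟶ P) (g : P ⟶ Q) :
    R.homEquiv s Q (f ≫ g) = g.hom.app (op s) (R.homEquiv s P f) := by
  change yonedaEquiv (R.unit.app s ≫ f.hom ≫ g.hom) = _
  rw [← Category.assoc]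
  exact yonedaEquiv_comp _ _

theorem ReflectedYoneda.homEquiv_map_comp (R : S.ReflectedYoneda) {s t : S.C} (k : s ⟶ t)
    {P : S.Hat} (f : R.functor.obj t ⟶ P) :
    R.homEquiv s P (R.functor.map k ≫ f) = P.obj.map k.op (R.homEquiv t P f) := by
  have h : R.unit.app s ≫ (R.functor.map k).hom ≫ f.hom =
      yoneda.map k ≫ R.unit.app t ≫ f.hom := by
    have := R.unit.naturality k
    rw [← Category.assoc, ← Category.assoc]
    exact congrArg (· ≫ f.hom) this.symm
  change yonedaEquiv (R.unit.app s ≫ (R.functor.map k).hom ≫ f.hom) = _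
  rw [h]
  exact (yonedaEquiv_naturality _ _).symm

/-- The presheaf of morphisms from `J` to a local presheaf is that presheaf. -/
def ReflectedYoneda.nerveIso [LocallySmall.{w} S.Hat] (R : S.ReflectedYoneda) :
    nerve R.toShrink ≅ (ShrinkHoms.equivalence.{w} S.Hat).inverse ⋙ (comparison S).isLocal.ι :=
  NatIso.ofComponents
    (fun X => NatIso.ofComponents
      (fun s => (((ShrinkHoms.equivalence.{w} S.Hat).toAdjunction.homEquiv
        (R.functor.obj s.unop) X).trans (R.homEquiv s.unop _)).toIso)
      fun {s t} k => by
        ext f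
        refine Eq.trans (congrArg (R.homEquiv _ _)
          ((ShrinkHoms.equivalence.{w} S.Hat).toAdjunction.homEquiv_naturality_left
            (R.functor.map k.unop) f)) ?_
        exact R.homEquiv_map_comp k.unop _)
    fun {X Y} g => by
      ext s f
      refine Eq.trans (congrArg (R.homEquiv _ _)
        ((ShrinkHoms.equivalence.{w} S.Hat).toAdjunction.homEquiv_naturality_right f g)) ?_
      exact R.homEquiv_comp _ _

end

variable {S D : Sketch.{w}} [LocallySmall.{w} S.Hat] (R : S.ReflectedYoneda) (F : D ⟶ S)

/-- The presheaf of morphisms from `J ∘ F` to a local presheaf is its restriction along `F`. -/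
def nerveCompIso :
    nerve (functor F ⋙ R.toShrink) ≅ (ShrinkHoms.equivalence.{w} S.Hat).inverse ⋙
      hatRestriction F ⋙ (comparison D).isLocal.ι :=
  Functor.isoWhiskerRight R.nerveIso ((Functor.whiskeringLeft _ _ _).obj (functor F).op)

variable {F}

theorem IsMoritaEquivalence.fullyFaithful_nerve (hF : IsMoritaEquivalence F) :
    Nonempty (nerve (functor F ⋙ R.toShrink)).FullyFaithful := by
  have := hF.isEquivalence_hatRestriction
  exact ⟨(Functor.FullyFaithful.ofFullyFaithful ((ShrinkHoms.equivalence.{w} S.Hat).inverse ⋙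
    hatRestriction F ⋙ (comparison D).isLocal.ι)).ofIso (nerveCompIso R F).symm⟩

theorem IsMoritaEquivalence.essImage_nerve (hF : IsMoritaEquivalence F)
    {P : D.Cᵒᵖ ⥤ Type w} (hP : (comparison D).isLocal P) :
    (nerve (functor F ⋙ R.toShrink)).essImage P := by
  have := hF.isEquivalence_hatRestriction
  let G := (ShrinkHoms.equivalence.{w} S.Hat).inverse ⋙ hatRestriction F
  exact ⟨G.objPreimage ⟨P, hP⟩, ⟨(nerveCompIso R F).app _ ≪≫
    (comparison D).isLocal.ι.mapIso (G.objObjPreimageIso ⟨P, hP⟩)⟩⟩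

/-- The morphism `J : S ⟶ classifier R`. -/
abbrev toClassifierHom : S ⟶ classifier R :=
  toClassifier R

/-- Whiskering along the composite of `F` and `J` is bijective: this composite is dense with
essentially small canonical diagrams, whose colimits `H` preserves. Whiskering along `F` is
bijective by the Morita property, and it can be cancelled. -/
theorem IsMoritaEquivalence.bijective_whiskerLeft_toClassifier (hD : D.IsSmall)
    (hF : IsMoritaEquivalence F) {M : Sketch.{w}} (hM : M.IsLeft) (H K : classifier R ⟶ M) :
    Function.Bijective fun α : functor H ⟶ functor K => Functor.whiskerLeft R.toShrink α := by
  have := hD.essentiallySmall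
  obtain ⟨hn⟩ := hF.fullyFaithful_nerve R
  have h₁ : Function.Bijective fun α : functor H ⟶ functor K =>
      Functor.whiskerLeft (functor F ⋙ R.toShrink) α :=
    bijective_whiskerLeft_of_isColimit (B := ShrinkHoms S.Hat) fun X =>
      hM.isLeftModel_functor H _ (nonempty_isColimit_canonicalCocone hn X)
  have := hF M hM
  have h₂ : Function.Bijective fun α : R.toShrink ⋙ functor H ⟶ R.toShrink ⋙ functor K =>
      Functor.whiskerLeft (functor F) α :=
    (Functor.FullyFaithful.ofFullyFaithful (Bicategory.precomp M F)).map_bijective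
      (toClassifierHom R ≫ H) (toClassifierHom R ≫ K)
  exact (Function.Bijective.of_comp_iff' h₂ _).1 h₁

theorem IsMoritaEquivalence.exists_extension_toClassifier (hD : D.IsSmall)
    (hF : IsMoritaEquivalence F) {M : Sketch.{w}} (hM : M.IsLeft) (G : S ⟶ M) :
    ∃ H : classifier R ⟶ M, Nonempty (toClassifierHom R ≫ H ≅ G) := by
  have := hD.essentiallySmall
  have := hM.cocomplete
  obtain ⟨hn⟩ := hF.fullyFaithful_nerve R
  obtain ⟨H, hH, ⟨i⟩⟩ := exists_isLeftAdjoint_extension (functor F ⋙ R.toShrink) hn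
    (functor F ⋙ functor G) fun m => hF.essImage_nerve R
      (isLocal_of_isLeftModel (hM.isLeftModel_functor (F ≫ G)) m)
  have hRH : S.IsLeftModel (R.toShrink ⋙ H) := by
    intro J _ _ d δ hδ
    obtain ⟨h⟩ := R.isColimit δ hδ
    exact ⟨isColimitOfPreserves H
      (isColimitOfPreserves (ShrinkHoms.equivalence.{w} S.Hat).functor h)⟩
  have hG : S.IsLeftModel (functor G) := hM.isLeftModel_functor G
  -- The target is `ofCategory M.C` rather than `M`, because `R.toShrink ⋙ H` is so far known only
  -- to be a left model, with nothing about cones.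
  have := hF _ (isLeft_ofCategory M.C)
  let i' : (Bicategory.precomp (ofCategory M.C) F).obj hRH.hom ≅
      (Bicategory.precomp (ofCategory M.C) F).obj hG.hom :=
    isoOfNatIso (F := F ≫ hRH.hom) (G := F ≫ hG.hom) i
  let k := (Bicategory.precomp (ofCategory M.C) F).preimageIso i'
  let k' : R.toShrink ⋙ H ≅ functor G :=
    { hom := natTrans k.hom, inv := natTrans k.inv,
      hom_inv_id := k.hom_inv_id, inv_hom_id := k.inv_hom_id }
  have hHc : ∀ {J : Type (w + 1)} [Category.{w} J] (d : J ⥤ ShrinkHoms S.Hat) (c : Cocone d),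
      IsColimit c → Nonempty (IsColimit (H.mapCocone c)) :=
    fun _ _ h => ⟨isColimitOfPreserves H h⟩
  let H' : Hom (classifier R) M :=
    { functor := H
      map_cone := by
        -- Specified cones of the classifier are images under `J`, so `k'` compares their images
        -- under `H` with those under the sketch morphism `G`.
        rintro J _ _ _ _ ⟨c, hc⟩
        obtain ⟨d', c', hc', h⟩ := Hom.map_cone G c hc
        exact ⟨d', c', hc', (ConeNatIso.of_functor_iso k' c).trans h⟩
      map_cocone := fun c hc =>
        ⟨_, H.mapCocone c, (hM.isCocone_iff _).2 (hHc _ c hc.some),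
          CoconeNatIso.refl _⟩ }
  exact ⟨H', ⟨isoOfNatIso (F := toClassifierHom R ≫ (H' : classifier R ⟶ M)) (G := G) k'⟩⟩

theorem IsMoritaSmall.isMoritaEquivalence_toClassifier (hS : S.IsMoritaSmall) :
    IsMoritaEquivalence (toClassifierHom R) := by
  obtain ⟨D, F, hD, hF⟩ := hS
  intro M hM
  exact
    { faithful := ⟨fun {H K} {_ _} h =>
        (hF.bijective_whiskerLeft_toClassifier R hD hM H K).1 h⟩
      full := ⟨fun {H K} => (hF.bijective_whiskerLeft_toClassifier R hD hM H K).2⟩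
      essSurj := ⟨fun G => hF.exists_extension_toClassifier R hD hM G⟩ }

theorem IsMoritaEquivalence.comp {S T X : Sketch.{w}} {F : S ⟶ T} {G : T ⟶ X}
    (hF : IsMoritaEquivalence F) (hG : IsMoritaEquivalence G) :
    IsMoritaEquivalence (F ≫ G) := fun M hM => by
  have := hF M hM
  have := hG M hM
  exact inferInstanceAs (Bicategory.precomp M G ⋙ Bicategory.precomp M F).IsEquivalence

theorem IsMoritaSmall.of_isMoritaEquivalence {S T : Sketch.{w}} {F : S ⟶ T}
    (hS : S.IsMoritaSmall) (hF : IsMoritaEquivalence F) : T.IsMoritaSmall := by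
  obtain ⟨D, G, hD, hG⟩ := hS
  exact ⟨D, G ≫ F, hD, hG.comp hF⟩

/-- In a left sketch representable presheaves are local. -/
def IsLeft.reflectedYoneda {T : Sketch.{w}} (hT : T.IsLeft) : T.ReflectedYoneda where
  functor := (comparison T).isLocal.lift yoneda fun X =>
    isLocal_of_isLeftModel (F := 𝟭 T.C) (hT.isLeftModel_functor (𝟙 T)) X
  unit := 𝟙 _
  bijective _ _ := ⟨fun _ _ h => ObjectProperty.hom_ext _
    ((Category.id_comp _).symm.trans (Eq.trans h (Category.id_comp _))),
    fun f => ⟨ObjectProperty.homMk f, Category.id_comp _⟩⟩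

/-- Representables are already local, so the reflection may be taken to be the identity. Yoneda
preserves limits, and the full inclusion of `T.Hat` reflects them. -/
theorem IsLeft.isRounded {T : Sketch.{w}} (hT : T.IsLeft)
    (h : ∀ {J : Type (w + 1)} [Category.{w} J] [EssentiallySmall.{w} J] {d : J ⥤ T.C}
      (c : Cone d), T.IsCone c → Nonempty (IsLimit c)) : T.IsRounded := by
  refine ⟨hT.reflectedYoneda, fun c hc => ?_⟩
  obtain ⟨hl⟩ := h c hc
  have : IsLimit ((comparison T).isLocal.ι.mapCone (hT.reflectedYoneda.functor.mapCone c)) :=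
    isLimitOfPreserves yoneda hl
  exact ⟨isLimitOfReflects _ this⟩

end Sketch

/-! ### The classifier of a Morita small rounded sketch as a Morita small logos -/

namespace RSktMObj

variable (S : RSktMObj.{w})

instance : LocallySmall.{w} S.sketch.Hat :=
  S.isMoritaSmall.locallySmall_hat

/-- A chosen reflection of the representable presheaves on a Morita small rounded sketch. -/
def reflectedYoneda : S.sketch.ReflectedYoneda :=
  S.isRounded.choose

/-- The left sketch classifier of a Morita small rounded sketch. -/
def cl : Sketch.{w} :=
  Sketch.classifier S.reflectedYoneda

/-- The universal morphism from a Morita small rounded sketch to its left sketch classifier. -/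
def η : S.sketch ⟶ S.cl :=
  Sketch.toClassifierHom S.reflectedYoneda

theorem isLeft_cl : S.cl.IsLeft :=
  Sketch.isLeft_classifier S.isMoritaSmall _

theorem isMoritaEquivalence_η : Sketch.IsMoritaEquivalence S.η :=
  S.isMoritaSmall.isMoritaEquivalence_toClassifier _

/-- The limit clause of roundedness is used here. -/
theorem isLimit_of_isCone_cl {J : Type (w + 1)} [Category.{w} J] [EssentiallySmall.{w} J]
    {d : J ⥤ S.cl.C} (c : Cone d) (hc : S.cl.IsCone c) : Nonempty (IsLimit c) := by
  obtain ⟨c, hc⟩ := hc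
  obtain ⟨h⟩ := S.isRounded.choose_spec c hc
  exact ⟨isLimitOfPreserves (ShrinkHoms.equivalence.{w} S.sketch.Hat).functor h⟩

theorem isLogos_cl : S.cl.IsLogos :=
  ⟨S.isLeft_cl, S.isLeft_cl.isRounded S.isLimit_of_isCone_cl⟩

theorem isMoritaSmall_cl : S.cl.IsMoritaSmall :=
  S.isMoritaSmall.of_isMoritaEquivalence S.isMoritaEquivalence_η

theorem isLeftClassifier_η : Sketch.IsLeftClassifier S.η :=
  ⟨inferInstance, S.reflectedYoneda, Bicategory.Equivalence.id _,
    ⟨Bicategory.rightUnitor S.η⟩⟩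

/-! ### The reflector on 1-cells and 2-cells, and its coherence -/

open Sketch Bicategory

variable (T X Y : RSktMObj.{w})

instance isEquivalence_precomp_η : (precomp T.cl S.η).IsEquivalence :=
  S.isMoritaEquivalence_η _ T.isLeft_cl

variable {S T X Y}

/-- Reduces each pseudofunctor law to components at objects `η s`, where the cells have explicit
formulas. -/
theorem hom₂_ext {M : Sketch.{w}} (hM : M.IsLeft) {H K : S.cl ⟶ M} {α β : H ⟶ K}
    (h : ∀ s : S.sketch.C, (natTrans α).app ((functor S.η).obj s) =
      (natTrans β).app ((functor S.η).obj s)) : α = β := by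
  have := S.isMoritaEquivalence_η _ hM
  exact (precomp M S.η).map_injective (NatTrans.ext (funext h))

/-- The morphism of left sketch classifiers induced by a morphism of sketches. -/
def clMap (f : S.sketch ⟶ T.sketch) : S.cl ⟶ T.cl :=
  (precomp T.cl S.η).objPreimage (f ≫ T.η)

/-- The naturality isomorphism of `η`. -/
def clMapIso (f : S.sketch ⟶ T.sketch) : S.η ≫ clMap f ≅ f ≫ T.η :=
  (precomp T.cl S.η).objObjPreimageIso (f ≫ T.η)

/-- The components of the naturality isomorphism of `η`. -/
def clMapIsoApp (f : S.sketch ⟶ T.sketch) (s : S.sketch.C) :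
    (functor (clMap f)).obj ((functor S.η).obj s) ≅ (functor T.η).obj ((functor f).obj s) where
  hom := (natTrans (clMapIso f).hom).app s
  inv := (natTrans (clMapIso f).inv).app s
  hom_inv_id := NatTrans.congr_app (clMapIso f).hom_inv_id s
  inv_hom_id := NatTrans.congr_app (clMapIso f).inv_hom_id s

theorem clMapIsoApp_hom_naturality (f : S.sketch ⟶ T.sketch) {s t : S.sketch.C} (k : s ⟶ t) :
    (functor (clMap f)).map ((functor S.η).map k) ≫ (clMapIsoApp f t).hom =
      (clMapIsoApp f s).hom ≫ (functor T.η).map ((functor f).map k) :=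
  (natTrans (clMapIso f).hom).naturality k

/-- The 2-cell out of a left sketch classifier with a given restriction along `η`. -/
def clLift {H K : S.cl ⟶ T.cl} (α : S.η ≫ H ⟶ S.η ≫ K) : H ⟶ K :=
  (precomp T.cl S.η).preimage α

theorem clLift_app {H K : S.cl ⟶ T.cl} (α : S.η ≫ H ⟶ S.η ≫ K) (s : S.sketch.C) :
    (natTrans (clLift α)).app ((functor S.η).obj s) = (natTrans α).app s :=
  NatTrans.congr_app ((precomp T.cl S.η).map_preimage α) s

/-- The invertible 2-cell out of a left sketch classifier with a given restriction along `η`. -/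
def clLiftIso {H K : S.cl ⟶ T.cl} (α : S.η ≫ H ≅ S.η ≫ K) : H ≅ K where
  hom := clLift α.hom
  inv := clLift α.inv
  hom_inv_id := hom₂_ext T.isLeft_cl fun s => by
    change (natTrans (clLift α.hom)).app _ ≫ (natTrans (clLift α.inv)).app _ = _
    rw [clLift_app, clLift_app]
    exact NatTrans.congr_app α.hom_inv_id s
  inv_hom_id := hom₂_ext T.isLeft_cl fun s => by
    change (natTrans (clLift α.inv)).app _ ≫ (natTrans (clLift α.hom)).app _ = _
    rw [clLift_app, clLift_app]
    exact NatTrans.congr_app α.inv_hom_id s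

/-- The action of the reflector on 2-cells. -/
def clMap₂ {f g : S.sketch ⟶ T.sketch} (α : f ⟶ g) : clMap f ⟶ clMap g :=
  clLift ((clMapIso f).hom ≫ α ▷ T.η ≫ (clMapIso g).inv)

theorem clMap₂_app {f g : S.sketch ⟶ T.sketch} (α : f ⟶ g) (s : S.sketch.C) :
    (natTrans (clMap₂ α)).app ((functor S.η).obj s) = (clMapIsoApp f s).hom ≫
      (functor T.η).map ((natTrans α).app s) ≫ (clMapIsoApp g s).inv :=
  clLift_app _ s

variable (S) in
/-- The reflector preserves identities. -/
def clMapId : clMap (𝟙 S.sketch) ≅ 𝟙 S.cl :=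
  clLiftIso (clMapIso (𝟙 S.sketch) ≪≫ λ_ S.η ≪≫ (ρ_ S.η).symm)

variable (S) in
theorem clMapId_hom_app (s : S.sketch.C) :
    (natTrans (clMapId S).hom).app ((functor S.η).obj s) = (clMapIsoApp (𝟙 S.sketch) s).hom := by
  refine (clLift_app _ s).trans ?_
  change (clMapIsoApp (𝟙 S.sketch) s).hom ≫ 𝟙 _ ≫ 𝟙 _ = _
  rw [Category.comp_id]
  exact Category.comp_id _

/-- The reflector preserves compositions. -/
def clMapComp (f : S.sketch ⟶ T.sketch) (g : T.sketch ⟶ X.sketch) :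
    clMap (f ≫ g) ≅ clMap f ≫ clMap g :=
  clLiftIso (clMapIso (f ≫ g) ≪≫ α_ _ _ _ ≪≫ whiskerLeftIso f (clMapIso g).symm ≪≫
    (α_ _ _ _).symm ≪≫ whiskerRightIso (clMapIso f).symm (clMap g) ≪≫ α_ _ _ _)

theorem clMapComp_hom_app (f : S.sketch ⟶ T.sketch) (g : T.sketch ⟶ X.sketch)
    (s : S.sketch.C) :
    (natTrans (clMapComp f g).hom).app ((functor S.η).obj s) = (clMapIsoApp (f ≫ g) s).hom ≫
      (clMapIsoApp g ((functor f).obj s)).inv ≫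
        (functor (clMap g)).map (clMapIsoApp f s).inv := by
  refine (clLift_app _ s).trans ?_
  change (clMapIsoApp (f ≫ g) s).hom ≫ 𝟙 _ ≫ (clMapIsoApp g ((functor f).obj s)).inv ≫ 𝟙 _ ≫
    (functor (clMap g)).map (clMapIsoApp f s).inv ≫ 𝟙 _ = _
  rw [Category.comp_id, Category.id_comp, Category.id_comp]

theorem clMapComp_inv_app (f : S.sketch ⟶ T.sketch) (g : T.sketch ⟶ X.sketch)
    (s : S.sketch.C) :
    (natTrans (clMapComp f g).inv).app ((functor S.η).obj s) =
      (functor (clMap g)).map (clMapIsoApp f s).hom ≫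
        (clMapIsoApp g ((functor f).obj s)).hom ≫ (clMapIsoApp (f ≫ g) s).inv := by
  refine (clLift_app _ s).trans ?_
  change ((((𝟙 _ ≫ (functor (clMap g)).map (clMapIsoApp f s).hom) ≫ 𝟙 _) ≫
    (clMapIsoApp g ((functor f).obj s)).hom) ≫ 𝟙 _) ≫ (clMapIsoApp (f ≫ g) s).inv = _
  rw [Category.comp_id, Category.comp_id, Category.id_comp]
  exact Category.assoc _ _ _

section Coherence

variable {E : Type u} [Category.{v} E]

theorem whiskerLeft_coherence {A A' P P' P₁ P₁' Q Q' : E} (a : A ≅ Q) (b : P ≅ Q) (c : P₁ ≅ P)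
    (k : Q ⟶ Q') (a' : A' ≅ Q') (b' : P' ≅ Q') (c' : P₁' ≅ P') (m : P₁ ⟶ P₁')
    (h : c.inv ≫ m = (b.hom ≫ k ≫ b'.inv) ≫ c'.inv) :
    a.hom ≫ k ≫ a'.inv = (a.hom ≫ b.inv ≫ c.inv) ≫ m ≫ c'.hom ≫ b'.hom ≫ a'.inv := by
  simp [reassoc_of% h]

theorem whiskerRight_coherence {C : Type u'} [Category.{v'} C] (H : C ⥤ E) {A A' Q Q' : E}
    {a₀ a₁ b₀ b₁ : C} (a : A ≅ Q) (b : H.obj b₀ ≅ Q) (c : a₀ ≅ b₀) (k : b₀ ⟶ b₁) (k' : Q ⟶ Q')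
    (a' : A' ≅ Q') (b' : H.obj b₁ ≅ Q') (c' : a₁ ≅ b₁) (h : H.map k ≫ b'.hom = b.hom ≫ k') :
    a.hom ≫ k' ≫ a'.inv = (a.hom ≫ b.inv ≫ H.map c.inv) ≫ H.map (c.hom ≫ k ≫ c'.inv) ≫
      H.map c'.hom ≫ b'.hom ≫ a'.inv := by
  have e : H.map c.inv ≫ H.map (c.hom ≫ k ≫ c'.inv) ≫ H.map c'.hom = H.map k := by
    simp [← Functor.map_comp]
  simp only [Category.assoc]
  rw [reassoc_of% e, reassoc_of% h, b.inv_hom_id_assoc]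

theorem associator_coherence {A A' P P₁ P₂ Q R R₁ V : E} (a : A ≅ Q) (b : P ≅ Q)
    (c : P₁ ≅ P) (d : P₂ ≅ P) (a' : A' ≅ Q) (t : V ≅ P₂) (r : R ≅ Q) (r₁ : R₁ ≅ R)
    (m : V ⟶ R₁) (k : Q ⟶ Q) (l : P₁ ⟶ V) (hk : k = 𝟙 Q) (hl : l = c.hom ≫ d.inv ≫ t.inv)
    (h : t.inv ≫ m = (d.hom ≫ b.hom ≫ r.inv) ≫ r₁.inv) :
    a.hom ≫ k ≫ a'.inv = (a.hom ≫ b.inv ≫ c.inv) ≫ l ≫ 𝟙 V ≫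
      m ≫ r₁.hom ≫ r.hom ≫ a'.inv := by
  simp [reassoc_of% h, hk, hl]

theorem leftUnitor_coherence {A B P Q : E} (a : A ≅ Q) (b : B ≅ Q) (c : P ≅ B) (k : Q ⟶ Q)
    (hk : k = 𝟙 Q) : a.hom ≫ k ≫ b.inv = (a.hom ≫ b.inv ≫ c.inv) ≫ c.hom ≫ 𝟙 B := by
  simp [hk]

theorem rightUnitor_coherence {A B P P' Q : E} (a : A ≅ Q) (b : B ≅ Q) (c : P ≅ Q)
    (d : P' ⟶ B) (n : P ⟶ P') (k : Q ⟶ Q) (hk : k = 𝟙 Q) (h : n ≫ d = c.hom ≫ b.inv) :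
    a.hom ≫ k ≫ b.inv = (a.hom ≫ c.inv ≫ n) ≫ d ≫ 𝟙 B := by
  simp [hk, h]

end Coherence

theorem clMap₂_id (f : S.sketch ⟶ T.sketch) : clMap₂ (𝟙 f) = 𝟙 (clMap f) :=
  hom₂_ext T.isLeft_cl fun s => by
    refine (clMap₂_app _ s).trans ?_
    change (clMapIsoApp f s).hom ≫ (functor T.η).map (𝟙 _) ≫ (clMapIsoApp f s).inv = 𝟙 _
    rw [CategoryTheory.Functor.map_id, Category.id_comp, Iso.hom_inv_id]

theorem clMap₂_comp {f g h : S.sketch ⟶ T.sketch} (α : f ⟶ g) (β : g ⟶ h) :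
    clMap₂ (α ≫ β) = clMap₂ α ≫ clMap₂ β :=
  hom₂_ext T.isLeft_cl fun s => by
    refine (clMap₂_app _ s).trans ?_
    change (clMapIsoApp f s).hom ≫
      (functor T.η).map ((natTrans α).app s ≫ (natTrans β).app s) ≫ (clMapIsoApp h s).inv =
        (natTrans (clMap₂ α)).app _ ≫ (natTrans (clMap₂ β)).app _
    rw [clMap₂_app, clMap₂_app]
    simp

theorem clMap₂_whiskerLeft (f : S.sketch ⟶ T.sketch) {g h : T.sketch ⟶ X.sketch} (α : g ⟶ h) :
    clMap₂ (f ◁ α) = (clMapComp f g).hom ≫ clMap f ◁ clMap₂ α ≫ (clMapComp f h).inv :=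
  hom₂_ext X.isLeft_cl fun s => by
    change _ = (natTrans (clMapComp f g).hom).app _ ≫
      (natTrans (clMap₂ α)).app ((functor (clMap f)).obj ((functor S.η).obj s)) ≫
        (natTrans (clMapComp f h).inv).app _
    rw [clMapComp_hom_app, clMapComp_inv_app, clMap₂_app]
    refine whiskerLeft_coherence (clMapIsoApp (f ≫ g) s) (clMapIsoApp g ((functor f).obj s))
      ((functor (clMap g)).mapIso (clMapIsoApp f s)) _ (clMapIsoApp (f ≫ h) s)
      (clMapIsoApp h ((functor f).obj s)) ((functor (clMap h)).mapIso (clMapIsoApp f s)) _ ?_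
    -- The component needed is at `clMap f (η s)`, which is only isomorphic to `η (f s)`; naturality
    -- along that isomorphism brings it to the known formula.
    refine ((natTrans (clMap₂ α)).naturality (clMapIsoApp f s).inv).trans ?_
    rw [clMap₂_app]
    rfl

theorem clMap₂_whiskerRight {f g : S.sketch ⟶ T.sketch} (α : f ⟶ g) (h : T.sketch ⟶ X.sketch) :
    clMap₂ (α ▷ h) = (clMapComp f h).hom ≫ clMap₂ α ▷ clMap h ≫ (clMapComp g h).inv :=
  hom₂_ext X.isLeft_cl fun s => by
    change _ = (natTrans (clMapComp f h).hom).app _ ≫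
      (functor (clMap h)).map ((natTrans (clMap₂ α)).app ((functor S.η).obj s)) ≫
        (natTrans (clMapComp g h).inv).app _
    rw [clMapComp_hom_app, clMapComp_inv_app, clMap₂_app, clMap₂_app]
    exact whiskerRight_coherence (functor (clMap h)) (clMapIsoApp (f ≫ h) s)
      (clMapIsoApp h ((functor f).obj s)) (clMapIsoApp f s)
      ((functor T.η).map ((natTrans α).app s)) _ (clMapIsoApp (g ≫ h) s)
      (clMapIsoApp h ((functor g).obj s)) (clMapIsoApp g s)
      (clMapIsoApp_hom_naturality h ((natTrans α).app s))

theorem clMap₂_associator (f : S.sketch ⟶ T.sketch) (g : T.sketch ⟶ X.sketch)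
    (h : X.sketch ⟶ Y.sketch) :
    clMap₂ (α_ f g h).hom = (clMapComp (f ≫ g) h).hom ≫ (clMapComp f g).hom ▷ clMap h ≫
      (α_ (clMap f) (clMap g) (clMap h)).hom ≫ clMap f ◁ (clMapComp g h).inv ≫
        (clMapComp f (g ≫ h)).inv :=
  hom₂_ext Y.isLeft_cl fun s => by
    refine (clMap₂_app _ s).trans ?_
    change (clMapIsoApp ((f ≫ g) ≫ h) s).hom ≫ (functor Y.η).map (𝟙 _) ≫
      (clMapIsoApp (f ≫ g ≫ h) s).inv = (natTrans (clMapComp (f ≫ g) h).hom).app _ ≫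
      (functor (clMap h)).map ((natTrans (clMapComp f g).hom).app ((functor S.η).obj s)) ≫
      𝟙 _ ≫ (natTrans (clMapComp g h).inv).app ((functor (clMap f)).obj ((functor S.η).obj s)) ≫
        (natTrans (clMapComp f (g ≫ h)).inv).app _
    rw [clMapComp_hom_app, clMapComp_hom_app, clMapComp_inv_app]
    refine associator_coherence (clMapIsoApp ((f ≫ g) ≫ h) s)
      (clMapIsoApp h ((functor g).obj ((functor f).obj s)))
      ((functor (clMap h)).mapIso (clMapIsoApp (f ≫ g) s))
      ((functor (clMap h)).mapIso (clMapIsoApp g ((functor f).obj s)))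
      (clMapIsoApp (f ≫ g ≫ h) s)
      ((functor (clMap h)).mapIso ((functor (clMap g)).mapIso (clMapIsoApp f s)))
      (clMapIsoApp (g ≫ h) ((functor f).obj s))
      ((functor (clMap (g ≫ h))).mapIso (clMapIsoApp f s)) _ _ _
      ((functor Y.η).map_id _) (((functor (clMap h)).map_comp _ _).trans
        (congrArg (_ ≫ ·) ((functor (clMap h)).map_comp _ _))) ?_
    refine ((natTrans (clMapComp g h).inv).naturality (clMapIsoApp f s).inv).trans ?_
    rw [clMapComp_inv_app]
    rfl

theorem clMap₂_leftUnitor (f : S.sketch ⟶ T.sketch) :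
    clMap₂ (λ_ f).hom = (clMapComp (𝟙 S.sketch) f).hom ≫ (clMapId S).hom ▷ clMap f ≫
      (λ_ (clMap f)).hom :=
  hom₂_ext T.isLeft_cl fun s => by
    refine (clMap₂_app _ s).trans ?_
    change (clMapIsoApp (𝟙 S.sketch ≫ f) s).hom ≫ (functor T.η).map (𝟙 _) ≫
      (clMapIsoApp f s).inv = (natTrans (clMapComp (𝟙 S.sketch) f).hom).app _ ≫
      (functor (clMap f)).map ((natTrans (clMapId S).hom).app ((functor S.η).obj s)) ≫ 𝟙 _
    rw [clMapComp_hom_app, clMapId_hom_app]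
    exact leftUnitor_coherence (clMapIsoApp (𝟙 S.sketch ≫ f) s) (clMapIsoApp f s)
      ((functor (clMap f)).mapIso (clMapIsoApp (𝟙 S.sketch) s)) _ ((functor T.η).map_id _)

theorem clMap₂_rightUnitor (f : S.sketch ⟶ T.sketch) :
    clMap₂ (ρ_ f).hom = (clMapComp f (𝟙 T.sketch)).hom ≫ clMap f ◁ (clMapId T).hom ≫
      (ρ_ (clMap f)).hom :=
  hom₂_ext T.isLeft_cl fun s => by
    refine (clMap₂_app _ s).trans ?_
    change (clMapIsoApp (f ≫ 𝟙 T.sketch) s).hom ≫ (functor T.η).map (𝟙 _) ≫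
      (clMapIsoApp f s).inv = (natTrans (clMapComp f (𝟙 T.sketch)).hom).app _ ≫
      (natTrans (clMapId T).hom).app ((functor (clMap f)).obj ((functor S.η).obj s)) ≫ 𝟙 _
    rw [clMapComp_hom_app]
    refine rightUnitor_coherence (clMapIsoApp (f ≫ 𝟙 T.sketch) s) (clMapIsoApp f s)
      (clMapIsoApp (𝟙 T.sketch) ((functor f).obj s)) _ _ _ ((functor T.η).map_id _) ?_
    refine ((natTrans (clMapId T).hom).naturality (clMapIsoApp f s).inv).trans ?_
    rw [clMapId_hom_app]
    rfl

/-- The left sketch classifier of a Morita small rounded sketch is a Morita small logos. -/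
def toLogM (S : RSktM.{w}) : LogM.{w} :=
  LogMObj.mk (cl S) (isMoritaSmall_cl S) (isLogos_cl S)

/-- The pseudofunctor sending a Morita small rounded sketch to its left sketch classifier. -/
def reflector : Pseudofunctor RSktM.{w} LogM.{w} where
  obj S := toLogM S
  map {S T} f := InducedBicategory.mkHom (F := LogMObj.sketch) (X := toLogM S) (Y := toLogM T)
    (clMap (S := S) (T := T) f.hom)
  map₂ {S T _ _} α := InducedBicategory.Hom₂.mk (clMap₂ (S := S) (T := T) α.hom)
  map₂_id {S T} f := InducedBicategory.Hom₂.ext (clMap₂_id (S := S) (T := T) f.hom)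
  map₂_comp {S T _ _ _} α β :=
    InducedBicategory.Hom₂.ext (clMap₂_comp (S := S) (T := T) α.hom β.hom)
  mapId S := InducedBicategory.isoMk (clMapId S)
  mapComp {S T X} f g :=
    InducedBicategory.isoMk (clMapComp (S := S) (T := T) (X := X) f.hom g.hom)
  map₂_whisker_left {S T X} f _ _ α := InducedBicategory.Hom₂.ext
    (clMap₂_whiskerLeft (S := S) (T := T) (X := X) f.hom α.hom)
  map₂_whisker_right {S T X} _ _ α h := InducedBicategory.Hom₂.ext
    (clMap₂_whiskerRight (S := S) (T := T) (X := X) α.hom h.hom)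
  map₂_associator {S T X Y} f g h := InducedBicategory.Hom₂.ext
    (clMap₂_associator (S := S) (T := T) (X := X) (Y := Y) f.hom g.hom h.hom)
  map₂_left_unitor {S T} f :=
    InducedBicategory.Hom₂.ext (clMap₂_leftUnitor (S := S) (T := T) f.hom)
  map₂_right_unitor {S T} f :=
    InducedBicategory.Hom₂.ext (clMap₂_rightUnitor (S := S) (T := T) f.hom)

/-! ### The unit as a pseudonatural transformation -/

theorem clMapIso_inv_naturality {f g : S.sketch ⟶ T.sketch} (α : f ⟶ g) :
    α ▷ T.η ≫ (clMapIso g).inv = (clMapIso f).inv ≫ S.η ◁ clMap₂ α := by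
  refine NatTrans.ext (funext fun s => ?_)
  change (functor T.η).map ((natTrans α).app s) ≫ (clMapIsoApp g s).inv =
    (clMapIsoApp f s).inv ≫ (natTrans (clMap₂ α)).app ((functor S.η).obj s)
  rw [clMap₂_app, Iso.inv_hom_id_assoc]

theorem clMapIso_inv_id :
    (clMapIso (𝟙 S.sketch)).inv ≫ S.η ◁ (clMapId S).hom = (λ_ S.η).hom ≫ (ρ_ S.η).inv := by
  refine NatTrans.ext (funext fun s => ?_)
  change (clMapIsoApp (𝟙 S.sketch) s).inv ≫
    (natTrans (clMapId S).hom).app ((functor S.η).obj s) = 𝟙 _ ≫ 𝟙 _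
  rw [clMapId_hom_app]
  exact (Iso.inv_hom_id _).trans (Category.comp_id _).symm

theorem clMapIso_inv_comp (f : S.sketch ⟶ T.sketch) (g : T.sketch ⟶ X.sketch) :
    (clMapIso (f ≫ g)).inv ≫ S.η ◁ (clMapComp f g).hom =
      (α_ f g X.η).hom ≫ f ◁ (clMapIso g).inv ≫ (α_ f T.η (clMap g)).inv ≫
        (clMapIso f).inv ▷ clMap g ≫ (α_ S.η (clMap f) (clMap g)).hom := by
  refine NatTrans.ext (funext fun s => ?_)
  change (clMapIsoApp (f ≫ g) s).inv ≫
    (natTrans (clMapComp f g).hom).app ((functor S.η).obj s) =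
      𝟙 _ ≫ (clMapIsoApp g ((functor f).obj s)).inv ≫ 𝟙 _ ≫
        (functor (clMap g)).map (clMapIsoApp f s).inv ≫ 𝟙 _
  rw [clMapComp_hom_app]
  refine (Iso.inv_hom_id_assoc _ _).trans ?_
  rw [Category.comp_id, Category.id_comp, Category.id_comp]
  rfl

/-- The unit of the bireflection. -/
def unit : Pseudofunctor.StrongTrans (Pseudofunctor.id RSktM.{w}) (reflector.comp inclusion) where
  app S := InducedBicategory.mkHom (F := RSktMObj.sketch) (η S)
  naturality {S T} f := InducedBicategory.isoMk (clMapIso (S := S) (T := T) f.hom).symm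
  naturality_naturality {S T _ _} α :=
    InducedBicategory.Hom₂.ext (clMapIso_inv_naturality (S := S) (T := T) α.hom)
  naturality_id S := InducedBicategory.Hom₂.ext (by
    refine Eq.trans ?_ ((clMapIso_inv_id (S := S)).trans ?_)
    · refine congrArg ((clMapIso (S := S) (T := S) (𝟙 (RSktMObj.sketch S))).inv ≫ ·)
        (congrArg ((η S) ◁ ·) ?_)
      -- The structure cells of the strict `inclusion` are identities, so the composite
      -- pseudofunctor has the cells of `reflector` up to an identity factor.
      exact Category.comp_id (clMapId S).hom
    · exact ((congrArg (· ≫ (λ_ (η S)).hom ≫ (ρ_ (η S)).inv) (id_whiskerRight _ _)).trans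
        (Category.id_comp _)).symm)
  naturality_comp {S T X} f g := InducedBicategory.Hom₂.ext (by
    refine Eq.trans ?_ ((clMapIso_inv_comp (S := S) (T := T) (X := X) f.hom g.hom).trans ?_)
    · refine congrArg ((clMapIso (S := S) (T := X) (f.hom ≫ g.hom)).inv ≫ ·)
        (congrArg ((η S) ◁ ·) ?_)
      exact Category.comp_id (clMapComp (S := S) (T := T) (X := X) f.hom g.hom).hom
    · exact ((congrArg (· ≫ _) (id_whiskerRight _ (η X))).trans (Category.id_comp _)).symm)

/-! ### The biadjunction and its counit -/

theorem isEquivalence_mapFunctor_inclusion (c c' : LogM.{w}) :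
    (inclusion.mapFunctor c c').IsEquivalence where
  faithful := ⟨fun h => InducedBicategory.Hom₂.ext
    (congrArg (InducedBicategory.Hom₂.hom (F := RSktMObj.sketch)) h)⟩
  full := ⟨fun g => ⟨InducedBicategory.Hom₂.mk g.hom, rfl⟩⟩
  essSurj := ⟨fun f => ⟨InducedBicategory.mkHom f.hom,
    ⟨InducedBicategory.isoMk (Iso.refl _)⟩⟩⟩

theorem isEquivalence_precomp_mkHom {b c : RSktM.{w}} (x : RSktM.{w}) (f : b ⟶ c)
    (h : (precomp (RSktMObj.sketch x) f.hom).IsEquivalence) :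
    (precomp x f).IsEquivalence where
  faithful := ⟨fun {_ _ _ _} k => InducedBicategory.Hom₂.ext
    ((precomp (RSktMObj.sketch x) f.hom).map_injective
      (congrArg (InducedBicategory.Hom₂.hom (F := RSktMObj.sketch)) k))⟩
  full := ⟨fun {_ _} k => ⟨InducedBicategory.Hom₂.mk
    ((precomp (RSktMObj.sketch x) f.hom).preimage k.hom), InducedBicategory.Hom₂.ext
      ((precomp (RSktMObj.sketch x) f.hom).map_preimage k.hom)⟩⟩
  essSurj := ⟨fun k => ⟨InducedBicategory.mkHom
    ((precomp (RSktMObj.sketch x) f.hom).objPreimage k.hom),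
    ⟨InducedBicategory.isoMk ((precomp (RSktMObj.sketch x) f.hom).objObjPreimageIso k.hom)⟩⟩⟩

/-- `G` extends the identity along the Morita equivalence `η`. Both `G ≫ η` and the identity of
`T.cl` restrict along `η` to `η` up to isomorphism, so they are isomorphic. -/
theorem exists_retraction_η (hT : T.sketch.IsLeft) :
    ∃ G : T.cl ⟶ T.sketch, Nonempty (T.η ≫ G ≅ 𝟙 _) ∧ Nonempty (G ≫ T.η ≅ 𝟙 _) := by
  have := T.isMoritaEquivalence_η _ hT
  let G := (precomp T.sketch T.η).objPreimage (𝟙 _)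
  let i : T.η ≫ G ≅ 𝟙 _ := (precomp T.sketch T.η).objObjPreimageIso (𝟙 _)
  exact ⟨G, ⟨i⟩, ⟨clLiftIso ((α_ _ _ _).symm ≪≫ whiskerRightIso i T.η ≪≫ λ_ _ ≪≫
    (ρ_ _).symm)⟩⟩

theorem exists_counit_equivalence (c : LogM.{w}) :
    ∃ e : Bicategory.Equivalence (reflector.obj (inclusion.obj c)) c,
      Nonempty (unit.app (inclusion.obj c) ≫ inclusion.map e.hom ≅ 𝟙 (inclusion.obj c)) := by
  obtain ⟨G, ⟨i⟩, ⟨k⟩⟩ := exists_retraction_η (T := inclusion.obj c) (LogMObj.isLogos c).isLeft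
  let G' : reflector.obj (inclusion.obj c) ⟶ c := InducedBicategory.mkHom G
  let η' : c ⟶ reflector.obj (inclusion.obj c) :=
    InducedBicategory.mkHom (η (inclusion.obj c))
  -- The two isomorphisms need not satisfy the triangle identities; the counit is adjusted to make
  -- them hold.
  exact ⟨Bicategory.Equivalence.mkOfAdjointifyCounit (f := G') (g := η')
    (InducedBicategory.isoMk k.symm) (InducedBicategory.isoMk i),
    ⟨InducedBicategory.isoMk i⟩⟩

/-- The Morita small logoi are bireflective in the Morita small rounded sketches. -/
def bireflection : Bireflection inclusion.{w} where
  reflector := reflector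
  unit := unit
  homEquivalence b c := by
    have h₁ := isEquivalence_mapFunctor_inclusion (reflector.obj b) c
    have h₂ := isEquivalence_precomp_mkHom (inclusion.obj c) (unit.app b)
      (isMoritaEquivalence_η b _ (LogMObj.isLogos c).isLeft)
    exact @Functor.isEquivalence_trans _ _ _ _ _ _ _ _ h₁ h₂
  local_equivalence := isEquivalence_mapFunctor_inclusion
  counit_equivalence := exists_counit_equivalence

end RSktMObj

end LogosTheory

end

theorem mainTheorem1 :
    ∃ r : LogosTheory.Bireflection LogosTheory.inclusion.{w},
      ∀ S : LogosTheory.RSktM.{w},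
        LogosTheory.Sketch.IsLeftClassifier (r.unit.app S).hom ∧
        ∀ T : LogosTheory.Sketch.{w}, T.IsLogos →
          (Bicategory.precomp T (r.unit.app S).hom).IsEquivalence :=
  ⟨LogosTheory.RSktMObj.bireflection, fun S =>
    ⟨LogosTheory.RSktMObj.isLeftClassifier_η S, fun T hT =>
      LogosTheory.RSktMObj.isMoritaEquivalence_η S T hT.isLeft⟩⟩
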